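/- Let $P\subset\mathbb R^n$ be a simple $n$-polytope with facets $F_1,\dots,F_m$, and let $\mathbb Z_2=\mathbb Z/2\mathbb Z$. A vector-colouring of rank $r$ is a map $\Lambda\colon\{F_1,\dots,F_m\}\to\mathbb Z_2^r$, $F_i\mapsto\Lambda_i$, such that $\Lambda_1,\dots,\Lambda_m$ span $\mathbb Z_2^r$ and for every vertex of $P$ the vectors $\Lambda_i$ of the facets $F_i$ containing it are linearly independent. It defines the closed piecewise linear $n$-manifold $$M(P,\Lambda)=P\times\mathbb Z_2^r/\sim,\qquad (p,a)\sim(q,b)\iff p=q\ \text{ and }\ a-b\in\langle\Lambda_i\colon p\in F_i\rangle,$$ whose piecewise linear structure is the one in which the $2^r$ copies of $P$ are embedded piecewise linearly. Let $\Lambda$ be a vector-colouring of rank $r$ such that $M(P,\Lambda)$ is not orientable, and let $\Lambda_{j_1},\dots,\Lambda_{j_r}$ be a basis of $\mathbb Z_2^r$. Call a vector of $\mathbb Z_2^r$ odd or even according to the parity of the number of its nonzero coordinates in this basis. Then some $\Lambda_{i_0}$ is even, and for every such $i_0$ the following holds. Regard $\mathbb Z_2^r$ as the subspace of $\mathbb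 Z_2^{r+1}$ of vectors with last coordinate $0$, put $e_{r+1}=(0,\dots,0,1)$, let $$\widehat\Lambda_k=\begin{cases}\Lambda_k,&\text{if }\Lambda_k\text{ is odd},\\ \Lambda_k+(e_{r+1}+\Lambda_{i_0}),&\text{if }\Lambda_k\text{ is even},\end{cases}\qquad k=1,\dots,m,$$ and let $\Pi\colon\mathbb Z_2^{r+1}\to\mathbb Z_2^r$ be the linear map that is the identity on $\mathbb Z_2^r$ and has $\Pi(e_{r+1})=\Lambda_{i_0}$; it satisfies $\Pi(\widehat\Lambda_k)=\Lambda_k$ for all $k$. Then 1. $\widehat\Lambda$ is a vector-colouring of rank $r+1$; 2. $M(P,\widehat\Lambda)$ is orientable; 3. the map $\pi\colon M(P,\widehat\Lambda)\to M(P,\Lambda)$, $[p,a]\mapsto[p,\Pi(a)]$, is a well-defined two-sheeted covering, and it is the orientation double cover of $M(P,\Lambda)$: there is a homeomorphism over $M(P,\Lambda)$ from $M(P,\widehat\Lambda)$ onto the space of pairs $(x,o)$ of a point $x\in M(P,\Lambda)$ and a local orientation $o$ of $M(P,\Lambda)$ at $x$. -/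

import Mathlib

open Topology

noncomputable section

/-! ### Geometric simple polytopes -/

/-- The intersection of the half-spaces `⟪u i, x⟫ ≤ c i`. -/
def halfspaceInter {n m : ℕ} (u : Fin m → EuclideanSpace ℝ (Fin n)) (c : Fin m → ℝ) :
    Set (EuclideanSpace ℝ (Fin n)) :=
  {x | ∀ i, inner ℝ (u i) x ≤ c i}

/-- A geometric simple `n`-polytope in `ℝⁿ` with `m` facets: a bounded intersection of half-spaces
with non-empty interior, none of the `m` inequalities being redundant (so that the facets are
exactly the `m` distinct sets on which one of the inequalities is an equality), such that
every vertex lies in exactly `n` facets. -/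
structure SimplePolytope (n m : ℕ) where
  normal : Fin m → EuclideanSpace ℝ (Fin n)
  offset : Fin m → ℝ
  bounded : Bornology.IsBounded (halfspaceInter normal offset)
  full_dim : (interior (halfspaceInter normal offset)).Nonempty
  irredundant : ∀ i, ∃ x, (∀ j, j ≠ i → inner ℝ (normal j) x ≤ offset j) ∧
    offset i < inner ℝ (normal i) x
  simple : ∀ v ∈ Set.extremePoints ℝ (halfspaceInter normal offset),
    {i | inner ℝ (normal i) v = offset i}.ncard = n

namespace SimplePolytope

variable {n m : ℕ} (P : SimplePolytope n m)

/-- The polytope as a set of points. -/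
def carrier : Set (EuclideanSpace ℝ (Fin n)) := halfspaceInter P.normal P.offset

/-- The `i`-th facet `F_i`. -/
def facet (i : Fin m) : Set (EuclideanSpace ℝ (Fin n)) :=
  {x | x ∈ P.carrier ∧ inner ℝ (P.normal i) x = P.offset i}

/-- `Λ` is a vector-colouring of rank `r`: the vectors `Λ_i` span `ℤ₂^r`, and at every vertex
of `P` the vectors of the facets containing it are linearly independent. -/
def IsVectorColouring {r : ℕ} (Λ : Fin m → (Fin r → ZMod 2)) : Prop :=
  Submodule.span (ZMod 2) (Set.range Λ) = ⊤ ∧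
  ∀ v ∈ Set.extremePoints ℝ P.carrier,
    LinearIndependent (ZMod 2) (fun i : {i : Fin m // v ∈ P.facet i} => Λ i)

/-! ### The space `M(P, Λ)` -/

/-- `(p, a) ∼ (q, b)` iff `p = q` and `a - b ∈ ⟨Λ_i : p ∈ F_i⟩`. -/
def glue {r : ℕ} (Λ : Fin m → (Fin r → ZMod 2)) : Setoid (P.carrier × (Fin r → ZMod 2)) where
  r x y := x.1 = y.1 ∧
    x.2 - y.2 ∈ Submodule.span (ZMod 2) (Λ '' {i | (x.1 : EuclideanSpace ℝ (Fin n)) ∈ P.facet i})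
  iseqv :=
    { refl := fun x => ⟨rfl, by simp⟩
      symm := by
        rintro ⟨p, a⟩ ⟨q, b⟩ ⟨h, h'⟩
        dsimp only at h h'
        subst h
        exact ⟨rfl, by simpa using Submodule.neg_mem _ h'⟩
      trans := by
        rintro ⟨p, a⟩ ⟨q, b⟩ ⟨s, c⟩ ⟨h, h'⟩ ⟨k, k'⟩
        dsimp only at h h' k k'
        subst h
        subst k
        exact ⟨rfl, by simpa using Submodule.add_mem _ h' k'⟩ }

/-- `M(P, Λ) = P × ℤ₂^r / ∼`, where `ℤ₂^r` is discrete. -/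
def Space {r : ℕ} (Λ : Fin m → (Fin r → ZMod 2)) : Type := Quotient (P.glue Λ)

instance {r : ℕ} (Λ : Fin m → (Fin r → ZMod 2)) : TopologicalSpace (P.Space Λ) :=
  inferInstanceAs (TopologicalSpace (Quotient (P.glue Λ)))

/-- The point `[p, a]` of `M(P, Λ)`. -/
def point {r : ℕ} (Λ : Fin m → (Fin r → ZMod 2)) (p : P.carrier) (a : Fin r → ZMod 2) : P.Space Λ :=
  Quotient.mk (P.glue Λ) (p, a)

/-- A linear map `f : ℤ₂^r → ℤ₂^s` with `f ∘ Λ₁ = Λ₂` induces the map `M(P, Λ₁) → M(P, Λ₂)`,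
`[p, a] ↦ [p, f a]`. -/
def inducedMap {r s : ℕ} {Λ₁ : Fin m → (Fin r → ZMod 2)} {Λ₂ : Fin m → (Fin s → ZMod 2)}
    (f : (Fin r → ZMod 2) →ₗ[ZMod 2] (Fin s → ZMod 2)) (hf : ∀ i, f (Λ₁ i) = Λ₂ i) :
    P.Space Λ₁ → P.Space Λ₂ :=
  Quotient.lift (fun x => P.point Λ₂ x.1 (f x.2)) (by
    rintro ⟨p, a⟩ ⟨q, b⟩ ⟨h, h'⟩
    dsimp only at h h'
    subst h
    refine Quotient.sound ⟨rfl, ?_⟩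
    have := Submodule.mem_map_of_mem (f := f) h'
    rw [Submodule.map_span, Set.image_image] at this
    simpa [hf] using this)

end SimplePolytope

/-! ### Piecewise linear maps and orientations -/

/-- A convex polyhedron: a finite intersection of closed half-spaces. -/
def IsConvexPolyhedron {n : ℕ} (K : Set (EuclideanSpace ℝ (Fin n))) : Prop :=
  ∃ (k : ℕ) (u : Fin k → EuclideanSpace ℝ (Fin n)) (c : Fin k → ℝ), K = halfspaceInter u c

/-- The map `f`, defined on the subset `s` of `ℝⁿ`, is piecewise linear near the point `x` of `s`:
some neighbourhood of `x` in `s` is covered by finitely many convex polyhedra on each of which `f`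
is the restriction of an affine map. -/
def IsPLNear {n : ℕ} {s : Set (EuclideanSpace ℝ (Fin n))}
    (f : s → EuclideanSpace ℝ (Fin n)) (x : s) : Prop :=
  ∃ U ∈ 𝓝 x, ∃ (k : ℕ) (K : Fin k → Set (EuclideanSpace ℝ (Fin n)))
    (A : Fin k → (EuclideanSpace ℝ (Fin n) →ᵃ[ℝ] EuclideanSpace ℝ (Fin n))),
    (∀ i, IsConvexPolyhedron (K i)) ∧
    (∀ y ∈ U, ∃ i, (y : EuclideanSpace ℝ (Fin n)) ∈ K i) ∧
    ∀ y ∈ U, ∀ i, (y : EuclideanSpace ℝ (Fin n)) ∈ K i → f y = A i y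

/-- The charts of the natural piecewise linear structure on `M(P, Λ)`, which is glued from copies
of `P`: the homeomorphisms between open subsets of `M(P, Λ)` and of `ℝⁿ` that are piecewise linear
on every copy `P × {a}`. -/
def SimplePolytope.plCharts {n m r : ℕ} (P : SimplePolytope n m) (Λ : Fin m → (Fin r → ZMod 2)) :
    Set (OpenPartialHomeomorph (P.Space Λ) (EuclideanSpace ℝ (Fin n))) :=
  {φ | ∀ (a : Fin r → ZMod 2) (p : P.carrier), P.point Λ p a ∈ φ.source →
    IsPLNear (fun q : P.carrier => φ (P.point Λ q a)) p}

section Orientation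

variable {n : ℕ} {X : Type} [TopologicalSpace X]

/-- Two charts around `x` have the same orientation at `x`: the transition map
`ψ ∘ φ⁻¹` preserves the orientation near `φ x`. For charts of a piecewise linear structure the
transition map is a piecewise linear homeomorphism, which is differentiable on a dense open set,
and this means that its Jacobian determinant is positive wherever it exists near `φ x`. -/
def SameOrientationAt (x : X) (φ ψ : OpenPartialHomeomorph X (EuclideanSpace ℝ (Fin n))) : Prop :=
  ∀ᶠ z in 𝓝 (φ x), DifferentiableAt ℝ (fun w => ψ (φ.symm w)) z →
    0 < (fderiv ℝ (fun w => ψ (φ.symm w)) z).det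

/-- A manifold with piecewise linear structure `𝒞` (the set of all its piecewise linear charts) is
orientable if it has an atlas of charts in `𝒞` whose transition maps all preserve the
orientation. -/
def IsOrientable (𝒞 : Set (OpenPartialHomeomorph X (EuclideanSpace ℝ (Fin n)))) : Prop :=
  ∃ 𝒜 ⊆ 𝒞, (∀ x, ∃ φ ∈ 𝒜, x ∈ φ.source) ∧
    ∀ φ ∈ 𝒜, ∀ ψ ∈ 𝒜, ∀ x, x ∈ φ.source → x ∈ ψ.source → SameOrientationAt x φ ψ

/-- The local orientations of a manifold at `x`: the piecewise linear charts around `x` up to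
having the same orientation at `x`. (There are exactly two in positive dimension.) -/
def LocalOrientation (𝒞 : Set (OpenPartialHomeomorph X (EuclideanSpace ℝ (Fin n)))) (x : X) :
    Type :=
  Quot (fun φ ψ : {φ : OpenPartialHomeomorph X (EuclideanSpace ℝ (Fin n)) //
    φ ∈ 𝒞 ∧ x ∈ φ.source} => SameOrientationAt x φ.1 ψ.1)

/-- The orientation double cover of a manifold: the set of pairs of a point `x` and a local
orientation at `x`. -/
def OrientationCover (𝒞 : Set (OpenPartialHomeomorph X (EuclideanSpace ℝ (Fin n)))) : Type :=
  Σ x : X, LocalOrientation 𝒞 x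

/-- The part of the orientation double cover lying over an open set `U` on which the local
orientation is given by the chart `φ`. -/
def OrientationCover.sheet {𝒞 : Set (OpenPartialHomeomorph X (EuclideanSpace ℝ (Fin n)))}
    (φ : OpenPartialHomeomorph X (EuclideanSpace ℝ (Fin n))) (hφ : φ ∈ 𝒞) (U : Set X) :
    Set (OrientationCover 𝒞) :=
  {y | ∃ (x : X) (hx : x ∈ φ.source), x ∈ U ∧ y = ⟨x, Quot.mk _ ⟨φ, hφ, hx⟩⟩}

/-- The topology whose basis consists of the sheets over open subsets of chart domains. -/
instance (𝒞 : Set (OpenPartialHomeomorph X (EuclideanSpace ℝ (Fin n)))) :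
    TopologicalSpace (OrientationCover 𝒞) :=
  TopologicalSpace.generateFrom
    {S | ∃ (φ : OpenPartialHomeomorph X (EuclideanSpace ℝ (Fin n))) (hφ : φ ∈ 𝒞) (U : Set X),
      IsOpen U ∧ U ⊆ φ.source ∧ S = OrientationCover.sheet φ hφ U}

end Orientation

/-! ### The modified colouring -/

/-- The number of non-zero coordinates of `v` in the basis `b`. -/
def numNonzeroCoords {r : ℕ} (b : Module.Basis (Fin r) (ZMod 2) (Fin r → ZMod 2))
    (v : Fin r → ZMod 2) : ℕ :=
  {s | b.repr v s ≠ 0}.ncard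

/-- The inclusion of `ℤ₂^r` into `ℤ₂^(r+1)` as the set of vectors with last coordinate zero. -/
def inclLast {r : ℕ} (v : Fin r → ZMod 2) : Fin (r + 1) → ZMod 2 :=
  Fin.snoc (α := fun _ => ZMod 2) v 0

/-- The vector `e_{r+1}`. -/
def lastVec (r : ℕ) : Fin (r + 1) → ZMod 2 := Pi.single (Fin.last r) 1

/-- The colouring `Λ̂` with values in `ℤ₂^(r+1)`. -/
def doubleColouring {m r : ℕ} (Λ : Fin m → (Fin r → ZMod 2))
    (b : Module.Basis (Fin r) (ZMod 2) (Fin r → ZMod 2)) (i₀ : Fin m) :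
    Fin m → (Fin (r + 1) → ZMod 2) :=
  fun k => if Odd (numNonzeroCoords b (Λ k)) then inclLast (Λ k)
    else inclLast (Λ k) + (lastVec r + inclLast (Λ i₀))

/-- The linear map `Π : ℤ₂^(r+1) → ℤ₂^r` that is the identity on `ℤ₂^r` and maps `e_{r+1}` to
`w`. -/
def collapseLast {r : ℕ} (w : Fin r → ZMod 2) :
    (Fin (r + 1) → ZMod 2) →ₗ[ZMod 2] (Fin r → ZMod 2) where
  toFun v := (fun s => v s.castSucc) + v (Fin.last r) • w
  map_add' v v' := by ext s; simp; ring
  map_smul' c v := by ext s; simp; ring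

theorem collapseLast_inclLast {r : ℕ} (w v : Fin r → ZMod 2) :
    collapseLast w (inclLast v) = v := by
  ext s; simp [collapseLast, inclLast]

theorem collapseLast_lastVec {r : ℕ} (w : Fin r → ZMod 2) :
    collapseLast w (lastVec r) = w := by
  ext s; simp [collapseLast, lastVec]

theorem collapseLast_doubleColouring {m r : ℕ} (Λ : Fin m → (Fin r → ZMod 2))
    (b : Module.Basis (Fin r) (ZMod 2) (Fin r → ZMod 2)) (i₀ k : Fin m) :
    collapseLast (Λ i₀) (doubleColouring Λ b i₀ k) = Λ k := by
  unfold doubleColouring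
  split_ifs
  · exact collapseLast_inclLast _ _
  · rw [map_add, map_add, collapseLast_inclLast, collapseLast_lastVec, collapseLast_inclLast]
    ext s
    simp [CharTwo.add_self_eq_zero]

/-- The map `M(P, Λ̂) → M(P, Λ)`, `[p, a] ↦ [p, Π a]`. -/
def doubleCoverMap {n m r : ℕ} (P : SimplePolytope n m) (Λ : Fin m → (Fin r → ZMod 2))
    (b : Module.Basis (Fin r) (ZMod 2) (Fin r → ZMod 2)) (i₀ : Fin m) :
    P.Space (doubleColouring Λ b i₀) → P.Space Λ :=
  P.inducedMap (collapseLast (Λ i₀)) (collapseLast_doubleColouring Λ b i₀)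

end

/-!
Suppose that a linear functional `l` on `ℤ₂^r` takes the value `1` on all colours. Orienting each
copy `P × {a}` of the polytope by the sign `(-1)^(l a)` then orients `M(P, Λ)`, since two copies
glued along a facet carry opposite signs and are unfolded by a reflection
(`SimplePolytope.isOrientable_of_functional`). The sum of the coordinates in the basis `b` is such
a functional if all colours are odd; hence a non-orientable `M(P, Λ)` has an even colour. For the
doubled colouring, the coordinate sum plus the last coordinate is such a functional, and it takes
the value `1` on the vector `κ = e_{r+1} + Λ_{i₀}` that spans the kernel of `Π`. These facts are
recorded in `SimplePolytope.IsDoubling`, and the rest of the theorem follows from them.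

*Charts.* As `P` is simple, the normals of the facets at a vertex `v` are linear coordinates of
`ℝⁿ`, and the copies of `P` meeting at `[v, a]` unfold onto the orthants of these coordinates. This
gives the standard charts `SimplePolytope.Vertex.chart`. Every face of `P` has a vertex, so these
charts cover `M(P, Λ)`. On the copy `P × {b}` such a chart flips as many coordinates as there are
facets at `v` in the expression of `b - a` through their colours; the parity of that number decides
which standard charts have the same orientation
(`SimplePolytope.Vertex.sameOrientationAt_chart_iff`).

*Local orientations.* The orientation cover is built from arbitrary piecewise linear charts, so it
has to be shown that these define exactly two local orientations at each point. The heart of this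
is `det_mul_det_pos`: all affine pieces through a point of a locally injective piecewise linear map
have determinants of the same sign. At a generic point of a wall between two pieces the linear
parts differ by a transvection, whose determinant is positive by injectivity
(`det_mul_det_pos_of_wall`); two pieces are joined by a segment crossing one wall at a time.
Comparing all charts with a standard chart (`sameOrientationAt_iff`) then shows that having the same
orientation is an equivalence relation with at most two classes.

*The covering.* Translation by `κ` is an involution of `M(P, Λ̂)` whose quotient is `M(P, Λ)`. Over
the star of a vertex `v` the two sheets are distinguished by `l` minus the parity at `v`, which
vanishes on the colours at `v` and is `1` on `κ`; so the quotient map is a covering. A point `[p, c]`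
is sent to the local orientation at `[p, Π c]` which gives the copy `P × {Π c}` the sign
`(-1)^(l c)`. The two points of a fibre get opposite orientations, so this is a bijection onto the
orientation cover; it is continuous because it is locally constant on the sheets, and open because
the covering is an open map.
-/

/-! ### Affine maps near a wall -/

section PiecewiseLinear

variable {E : Type*} [NormedAddCommGroup E] [NormedSpace ℝ E]

theorem Filter.Eventually.along_ray {p : E → Prop} {z : E} (h : ∀ᶠ x in 𝓝 z, p x) (w : E) :
    ∀ᶠ t : ℝ in 𝓝[>] 0, p (z + t • w) := by
  have hc : ContinuousAt (fun t : ℝ => z + t • w) 0 := by fun_prop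
  have h' : ∀ᶠ t : ℝ in 𝓝 0, p (z + t • w) := hc.eventually (by simpa using h)
  exact h'.filter_mono nhdsWithin_le_nhds

theorem AffineMap.apply_add_smul {F : Type*} [AddCommGroup F] [Module ℝ F] (A : E →ᵃ[ℝ] F)
    (z w : E) (t : ℝ) : A (z + t • w) = A z + t • A.linear w := by
  have := A.map_vadd z (t • w)
  simp only [vadd_eq_add, map_smul] at this
  rw [add_comm z, this, add_comm]

theorem AffineMap.linear_injective_of_injOn {A : E →ᵃ[ℝ] E} {s : Set E}
    (hs : (interior s).Nonempty) (h : Set.InjOn A s) : Function.Injective A.linear := by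
  obtain ⟨y, hy⟩ := hs
  rw [injective_iff_map_eq_zero]
  intro k hk
  have hy' : ∀ᶠ x in 𝓝 y, x ∈ s := mem_interior_iff_mem_nhds.1 hy
  obtain ⟨t, ht, ht0⟩ := ((hy'.along_ray k).and self_mem_nhdsWithin).exists
  have := h ht (interior_subset hy) (by rw [A.apply_add_smul, hk]; simp)
  simpa [(show (0 : ℝ) < t from ht0).ne'] using this

theorem AffineMap.linear_det_ne_zero_of_injOn [FiniteDimensional ℝ E] {A : E →ᵃ[ℝ] E} {s : Set E}
    (hs : (interior s).Nonempty) (h : Set.InjOn A s) : LinearMap.det A.linear ≠ 0 := by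
  have := LinearMap.isUnit_iff_ker_eq_bot A.linear |>.2
    (LinearMap.ker_eq_bot.2 (A.linear_injective_of_injOn hs h))
  exact (LinearMap.isUnit_det _ this).ne_zero

theorem AffineMap.linear_eq_of_eqOn {A B : E →ᵃ[ℝ] E} {s : Set E}
    (hs : (interior s).Nonempty) (h : Set.EqOn A B s) : A.linear = B.linear := by
  obtain ⟨y, hy⟩ := hs
  ext k
  have hy' : ∀ᶠ x in 𝓝 y, x ∈ s := mem_interior_iff_mem_nhds.1 hy
  obtain ⟨t, ht, ht0⟩ := ((hy'.along_ray k).and self_mem_nhdsWithin).exists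
  have h1 := h ht
  rw [A.apply_add_smul, B.apply_add_smul, h (interior_subset hy), add_right_inj] at h1
  exact smul_right_injective E (show (0 : ℝ) < t from ht0).ne' h1

/-- Crossing a wall: if an injective map is affine on both sides of the hyperplane `g = 0` near one
of its points, the two linear parts differ by a transvection along the hyperplane, and injectivity
forces its determinant to be positive. -/
theorem det_mul_det_pos_of_wall [FiniteDimensional ℝ E] {f : E → E} {z : E} {A B : E →ᵃ[ℝ] E}
    {g : E →ᵃ[ℝ] ℝ} {U : Set E} (hU : U ∈ 𝓝 z) (hf : Set.InjOn f U) (hgz : g z = 0)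
    (hg : g.linear ≠ 0) (hA : ∀ᶠ x in 𝓝 z, g x ≤ 0 → f x = A x)
    (hB : ∀ᶠ x in 𝓝 z, 0 ≤ g x → f x = B x)
    (hdA : LinearMap.det A.linear ≠ 0) (hdB : LinearMap.det B.linear ≠ 0) :
    0 < LinearMap.det A.linear * LinearMap.det B.linear := by
  have hz : A z = B z := (hA.self_of_nhds hgz.le).symm.trans (hB.self_of_nhds hgz.ge)
  have hker : ∀ k, g.linear k = 0 → A.linear k = B.linear k := by
    intro k hk
    obtain ⟨t, ⟨h1, h2⟩, ht0⟩ := (((hA.and hB).along_ray k).and self_mem_nhdsWithin).exists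
    have hg0 : g (z + t • k) = 0 := by rw [g.apply_add_smul, hgz, hk]; simp
    have h3 := (h1 hg0.le).symm.trans (h2 hg0.ge)
    rw [A.apply_add_smul, B.apply_add_smul, hz, add_right_inj] at h3
    exact smul_right_injective E (show (0 : ℝ) < t from ht0).ne' h3
  obtain ⟨w, hw⟩ : ∃ w, g.linear w = 1 := LinearMap.surjective hg 1
  obtain ⟨w₀, hw₀⟩ : ∃ w₀, A.linear w₀ = B.linear w := by
    have : Function.Surjective A.linear := by
      have := (LinearMap.isUnit_iff_isUnit_det A.linear).2 hdA.isUnit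
      exact LinearMap.range_eq_top.1 ((LinearMap.isUnit_iff_range_eq_top _).1 this)
    exact this _
  have hBA : B.linear = A.linear * LinearMap.transvection g.linear (w₀ - w) := by
    ext v
    have h1 := hker (v - g.linear v • w) (by simp [hw])
    simp only [map_sub, map_smul, Module.End.mul_apply, LinearMap.transvection.apply, map_add,
      hw₀] at h1 ⊢
    rw [smul_sub, ← add_sub_assoc, add_sub_right_comm, h1]
    abel
  have hdet : LinearMap.det B.linear = LinearMap.det A.linear * g.linear w₀ := by
    rw [hBA, map_mul, LinearMap.transvection.det, map_sub, hw]; ring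
  have hne : g.linear w₀ ≠ 0 := fun h => hdB (by rw [hdet, h, mul_zero])
  have hpos : 0 < g.linear w₀ := by
    refine lt_of_le_of_ne (not_lt.1 fun hlt => ?_) hne.symm
    have hU' : ∀ᶠ x in 𝓝 z, x ∈ U := hU
    obtain ⟨t, ⟨⟨⟨h1, h2⟩, h3, h4⟩, ht0⟩⟩ := ((((hA.and hU').along_ray w₀).and
      ((hB.and hU').along_ray w)).and self_mem_nhdsWithin).exists
    have ht0 : (0 : ℝ) < t := ht0
    have e1 := h1 (by rw [g.apply_add_smul, hgz, smul_eq_mul]; nlinarith)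
    have e3 := h3 (by rw [g.apply_add_smul, hgz, smul_eq_mul, hw]; linarith)
    have e : f (z + t • w₀) = f (z + t • w) := by
      rw [e1, e3, A.apply_add_smul, B.apply_add_smul, hw₀, hz]
    have e' := smul_right_injective E ht0.ne' (add_left_cancel (hf h2 h4 e))
    rw [e', hw] at hlt
    linarith
  rw [hdet]
  have := mul_self_pos.2 hdA
  nlinarith [mul_pos this hpos]

theorem AffineMap.eq_zero_of_interior_nonempty {g : E →ᵃ[ℝ] ℝ} {s : Set E}
    (hs : (interior s).Nonempty) (h : ∀ x ∈ s, g x = 0) : g = 0 := by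
  obtain ⟨y, hy⟩ := hs
  have hy' : ∀ᶠ x in 𝓝 y, x ∈ s := mem_interior_iff_mem_nhds.1 hy
  have hlin : ∀ w, g.linear w = 0 := by
    intro w
    obtain ⟨t, ht, ht0⟩ := ((hy'.along_ray w).and self_mem_nhdsWithin).exists
    have ht := h _ ht
    rw [g.apply_add_smul, h _ (interior_subset hy), zero_add, smul_eq_mul] at ht
    exact (mul_eq_zero.1 ht).resolve_left (show (0 : ℝ) < t from ht0).ne'
  ext x
  have := g.apply_add_smul y (x - y) 1
  simpa [hlin, h _ (interior_subset hy)] using this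

theorem AffineMap.linear_ne_zero {g : E →ᵃ[ℝ] ℝ} {z : E} (hg : g ≠ 0) (hz : g z = 0) :
    g.linear ≠ 0 := by
  intro h
  refine hg ?_
  ext x
  have := g.apply_add_smul z (x - z) 1
  simpa [h, hz] using this

/-- Finitely many non-zero affine functionals have a common non-zero in every non-empty open
set. -/
theorem exists_forall_ne_zero_of_isOpen [FiniteDimensional ℝ E] {D : Set (E →ᵃ[ℝ] ℝ)}
    (hD : D.Finite) (h0 : ∀ g ∈ D, g ≠ 0) {V : Set E} (hV : IsOpen V) (hne : V.Nonempty) :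
    ∃ q ∈ V, ∀ g ∈ D, g q ≠ 0 := by
  have : Dense (⋂₀ ((fun g : E →ᵃ[ℝ] ℝ => {x | g x ≠ 0}) '' D)) := by
    refine (hD.image _).dense_sInter ?_ ?_
    · rintro _ ⟨g, -, rfl⟩
      exact isOpen_ne_fun g.continuous_of_finiteDimensional continuous_const
    · rintro _ ⟨g, hg, rfl⟩
      refine interior_eq_empty_iff_dense_compl.1
        (Set.eq_empty_iff_forall_notMem.2 ?_ : interior {x | g x = 0} = ∅)
      intro y hy
      exact h0 g hg (g.eq_zero_of_interior_nonempty ⟨y, hy⟩ fun x hx => hx)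
  obtain ⟨q, hq, hq'⟩ := this.inter_open_nonempty V hV hne
  exact ⟨q, hq, fun g hg => hq' _ ⟨g, hg, rfl⟩⟩

/-! ### Polyhedra and decompositions into convex pieces -/

/-- A polyhedron: the common solution set of finitely many affine inequalities `g x ≤ 0`. -/
def IsPolyhedron (K : Set E) : Prop :=
  ∃ F : Set (E →ᵃ[ℝ] ℝ), F.Finite ∧ K = {x | ∀ g ∈ F, g x ≤ 0}

theorem IsPolyhedron.convex {K : Set E} (hK : IsPolyhedron K) : Convex ℝ K := by
  obtain ⟨F, -, rfl⟩ := hK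
  have : {x : E | ∀ g ∈ F, g x ≤ 0} = ⋂ g ∈ F, g ⁻¹' Set.Iic 0 := by ext; simp
  rw [this]
  exact convex_iInter₂ fun g _ => (convex_Iic (0 : ℝ)).affine_preimage g

theorem IsPolyhedron.isClosed [FiniteDimensional ℝ E] {K : Set E} (hK : IsPolyhedron K) :
    IsClosed K := by
  obtain ⟨F, -, rfl⟩ := hK
  have : {x : E | ∀ g ∈ F, g x ≤ 0} = ⋂ g ∈ F, g ⁻¹' Set.Iic 0 := by ext; simp
  rw [this]
  exact isClosed_biInter fun g _ => isClosed_Iic.preimage g.continuous_of_finiteDimensional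

theorem IsPolyhedron.inter {K L : Set E} (hK : IsPolyhedron K) (hL : IsPolyhedron L) :
    IsPolyhedron (K ∩ L) := by
  obtain ⟨F, hF, rfl⟩ := hK
  obtain ⟨G, hG, rfl⟩ := hL
  refine ⟨F ∪ G, hF.union hG, ?_⟩
  ext x
  simp only [Set.mem_inter_iff, Set.mem_ofPred_eq, Set.mem_union]
  exact ⟨fun h g hg => hg.elim (h.1 g) (h.2 g), fun h => ⟨fun g hg => h g (.inl hg),
    fun g hg => h g (.inr hg)⟩⟩

theorem IsPolyhedron.preimage {K : Set E} (hK : IsPolyhedron K) (A : E →ᵃ[ℝ] E) :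
    IsPolyhedron (A ⁻¹' K) := by
  obtain ⟨F, hF, rfl⟩ := hK
  exact ⟨(fun g => g.comp A) '' F, hF.image _, by ext x; simp⟩

theorem Convex.interior_inter_nhds_nonempty {K U : Set E} (hK : Convex ℝ K)
    (hi : (interior K).Nonempty) {z : E} (hz : z ∈ K) (hU : U ∈ 𝓝 z) :
    (interior (K ∩ U)).Nonempty := by
  have hz' : z ∈ closure (interior K) := by
    rw [hK.closure_interior_eq_closure_of_nonempty_interior hi]
    exact subset_closure hz
  rw [interior_inter, Set.inter_comm]
  exact mem_closure_iff.1 hz' _ isOpen_interior (mem_interior_iff_mem_nhds.2 hU)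

/-- Finitely many convex bodies through `z` that cover a neighbourhood of `z`. -/
structure IsPieceDecomp {ι : Type} (K : ι → Set E) (z : E) : Prop where
  isClosed : ∀ i, IsClosed (K i)
  convex : ∀ i, Convex ℝ (K i)
  interior_nonempty : ∀ i, (interior (K i)).Nonempty
  mem : ∀ i, z ∈ K i
  cover : ∀ᶠ x in 𝓝 z, ∃ i, x ∈ K i

/-- Of finitely many polyhedra covering a neighbourhood of `z`, those that pass through `z` and
have non-empty interior already do: the others are closed and miss `z` or are nowhere dense. -/
theorem isPieceDecomp_of_cover [FiniteDimensional ℝ E] {ι : Type} [Finite ι] {K : ι → Set E}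
    {z : E} (hK : ∀ i, IsPolyhedron (K i)) (hc : ∀ᶠ x in 𝓝 z, ∃ i, x ∈ K i) :
    IsPieceDecomp (fun i : {i // z ∈ K i ∧ (interior (K i)).Nonempty} => K i) z where
  isClosed i := (hK i).isClosed
  convex i := (hK i).convex
  interior_nonempty i := i.2.2
  mem i := i.2.1
  cover := by
    have h1 : ∀ᶠ x in 𝓝 z, ∀ i, x ∈ K i → z ∈ K i := by
      refine Filter.eventually_all.2 fun i => ?_
      by_cases hi : z ∈ K i
      · exact .of_forall fun _ _ => hi
      · filter_upwards [(hK i).isClosed.isOpen_compl.mem_nhds hi] with x hx h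
        exact absurd h hx
    -- the degenerate pieces form a nowhere dense set
    have hdense : Dense (⋂ i ∈ {i | interior (K i) = ∅}, (K i)ᶜ) := by
      rw [Set.biInter_eq_iInter]
      have : Dense (⋂₀ Set.range (fun i : {i | interior (K i) = ∅} => (K i)ᶜ)) := by
        refine (Set.finite_range _).dense_sInter ?_ ?_
        · rintro _ ⟨i, rfl⟩
          exact (hK i).isClosed.isOpen_compl
        · rintro _ ⟨i, rfl⟩
          exact interior_eq_empty_iff_dense_compl.1 i.2
      rwa [Set.sInter_range] at this
    have h2 : ∀ᶠ x in 𝓝 z, ∃ i, x ∈ K i ∧ (interior (K i)).Nonempty := by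
      filter_upwards [hc.eventually_nhds] with x hx
      by_contra hcon
      push Not at hcon
      have hx' : ∀ᶠ y in 𝓝 x, ∀ i, y ∈ K i → x ∈ K i := by
        refine Filter.eventually_all.2 fun i => ?_
        by_cases hi : x ∈ K i
        · exact .of_forall fun _ _ => hi
        · filter_upwards [(hK i).isClosed.isOpen_compl.mem_nhds hi] with y hy h
          exact absurd h hy
      obtain ⟨V, hV, hVo, hxV⟩ := eventually_nhds_iff.1 (hx.and hx')
      obtain ⟨y, hy, hyd⟩ := hdense.inter_open_nonempty V hVo ⟨x, hxV⟩
      obtain ⟨⟨i, hi⟩, h⟩ := hV y hy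
      exact Set.mem_iInter₂.1 hyd i (hcon i (h i hi)) hi
    filter_upwards [h1, h2] with x hx ⟨i, hi, hi'⟩
    exact ⟨⟨i, hx i hi, hi'⟩, hi⟩

/-- A full-dimensional polyhedron contains, near a boundary point lying on a single one of its
bounding hyperplanes, a whole side of that hyperplane. -/
theorem halfSpace_subset_or {F : Set (E →ᵃ[ℝ] ℝ)} [FiniteDimensional ℝ E] (hF : F.Finite)
    (hi : (interior {x | ∀ g ∈ F, g x ≤ 0}).Nonempty) {z : E} (hz : ∀ g ∈ F, g z ≤ 0)
    {g₀ : E →ᵃ[ℝ] ℝ} (hg₀ : g₀ ≠ 0)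
    (hone : ∀ g ∈ F, g ≠ 0 → g z = 0 → ∃ c : ℝ, g = c • g₀) :
    (∀ᶠ x in 𝓝 z, g₀ x ≤ 0 → ∀ g ∈ F, g x ≤ 0) ∨
      ∀ᶠ x in 𝓝 z, 0 ≤ g₀ x → ∀ g ∈ F, g x ≤ 0 := by
  have hlt : ∀ᶠ x in 𝓝 z, ∀ g ∈ F, g z < 0 → g x < 0 := by
    refine (Filter.eventually_all_finite hF).2 fun g _ => ?_
    by_cases h : g z < 0
    · exact (g.continuous_of_finiteDimensional.continuousAt.eventually_lt
        continuousAt_const h).mono fun x hx _ => hx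
    · exact .of_forall fun x hx => absurd hx h
  by_cases h : ∀ g ∈ F, g z = 0 → ∃ c : ℝ, 0 ≤ c ∧ g = c • g₀
  · left
    filter_upwards [hlt] with x hx hx0 g hg
    rcases (hz g hg).lt_or_eq with h1 | h1
    · exact (hx g hg h1).le
    · obtain ⟨c, hc, rfl⟩ := h g hg h1
      exact mul_nonpos_of_nonneg_of_nonpos hc hx0
  · push Not at h
    obtain ⟨g₁, hg₁, hz₁, hc₁⟩ := h
    have hne : g₁ ≠ 0 := fun h0 => hc₁ 0 le_rfl (by simp [h0])
    obtain ⟨c₁, rfl⟩ := hone g₁ hg₁ hne hz₁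
    have hc₁' : c₁ < 0 := not_le.1 fun h0 => hc₁ c₁ h0 rfl
    right
    filter_upwards [hlt] with x hx hx0 g hg
    rcases (hz g hg).lt_or_eq with h1 | h1
    · exact (hx g hg h1).le
    · by_cases hg0 : g = 0
      · simp [hg0]
      obtain ⟨c, rfl⟩ := hone g hg hg0 h1
      rcases le_or_gt c 0 with hc | hc
      · exact mul_nonpos_of_nonpos_of_nonneg hc hx0
      · refine absurd (AffineMap.eq_zero_of_interior_nonempty hi fun y hy => ?_) hg₀
        have e1 : c₁ * g₀ y ≤ 0 := hy _ hg₁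
        have e2 : c * g₀ y ≤ 0 := hy _ hg
        nlinarith

/-- Two affine pieces of a locally injective map which meet at a point lying on at most one of
their bounding hyperplanes have determinants of the same sign. -/
theorem det_mul_det_pos_of_one_wall [FiniteDimensional ℝ E] {f : E → E} {z : E} {U : Set E}
    (hU : U ∈ 𝓝 z) (hf : Set.InjOn f U) {A B : E →ᵃ[ℝ] E} {F G : Set (E →ᵃ[ℝ] ℝ)}
    (hF : F.Finite) (hG : G.Finite)
    (hFi : (interior {x | ∀ g ∈ F, g x ≤ 0}).Nonempty)
    (hGi : (interior {x | ∀ g ∈ G, g x ≤ 0}).Nonempty)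
    (hFz : ∀ g ∈ F, g z ≤ 0) (hGz : ∀ g ∈ G, g z ≤ 0)
    (hA : ∀ᶠ x in 𝓝 z, (∀ g ∈ F, g x ≤ 0) → f x = A x)
    (hB : ∀ᶠ x in 𝓝 z, (∀ g ∈ G, g x ≤ 0) → f x = B x)
    (hone : ∀ g ∈ F ∪ G, ∀ g' ∈ F ∪ G, g ≠ 0 → g' ≠ 0 → g z = 0 → g' z = 0 → ∃ c : ℝ, g' = c • g) :
    0 < LinearMap.det A.linear * LinearMap.det B.linear := by
  have hdA : LinearMap.det A.linear ≠ 0 := by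
    refine A.linear_det_ne_zero_of_injOn (IsPolyhedron.convex ⟨F, hF, rfl⟩
      |>.interior_inter_nhds_nonempty hFi hFz (Filter.inter_mem hU hA)) ?_
    intro x hx y hy hxy
    exact hf hx.2.1 hy.2.1 (by rw [hx.2.2 hx.1, hy.2.2 hy.1, hxy])
  have hdB : LinearMap.det B.linear ≠ 0 := by
    refine B.linear_det_ne_zero_of_injOn (IsPolyhedron.convex ⟨G, hG, rfl⟩
      |>.interior_inter_nhds_nonempty hGi hGz (Filter.inter_mem hU hB)) ?_
    intro x hx y hy hxy
    exact hf hx.2.1 hy.2.1 (by rw [hx.2.2 hx.1, hy.2.2 hy.1, hxy])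
  -- two pieces sharing a convex body near `z` have the same linear part
  have same : ∀ S : Set E, Convex ℝ S → (interior S).Nonempty → z ∈ S →
      (∀ᶠ x in 𝓝 z, x ∈ S → (∀ g ∈ F, g x ≤ 0) ∧ ∀ g ∈ G, g x ≤ 0) →
      0 < LinearMap.det A.linear * LinearMap.det B.linear := by
    intro S hS hSi hSz hsub
    have : A.linear = B.linear := by
      refine AffineMap.linear_eq_of_eqOn (hS.interior_inter_nhds_nonempty hSi hSz
        (Filter.inter_mem hsub (Filter.inter_mem hA hB))) ?_
      rintro x ⟨hx, h1, h2, h3⟩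
      exact (h2 (h1 hx).1).symm.trans (h3 (h1 hx).2)
    rw [this]
    exact mul_self_pos.2 hdB
  by_cases hg : ∃ g ∈ F ∪ G, g ≠ 0 ∧ g z = 0
  · obtain ⟨g₀, hg₀, hne, hz₀⟩ := hg
    have hlin := AffineMap.linear_ne_zero hne hz₀
    obtain ⟨w, hw⟩ : ∃ w, g₀.linear w = 1 := LinearMap.surjective hlin 1
    have hcont := g₀.continuous_of_finiteDimensional
    rcases halfSpace_subset_or hF hFi hFz hne
      (fun g hg h0 h1 => hone g₀ hg₀ g (.inl hg) hne h0 hz₀ h1) with h1 | h1 <;>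
    rcases halfSpace_subset_or hG hGi hGz hne
      (fun g hg h0 h1 => hone g₀ hg₀ g (.inr hg) hne h0 hz₀ h1) with h2 | h2
    · refine same {x | g₀ x ≤ 0} ((convex_Iic (0 : ℝ)).affine_preimage g₀) ?_ hz₀.le
        ((h1.and h2).mono fun x h hx => ⟨h.1 hx, h.2 hx⟩)
      refine ⟨z + (-1 : ℝ) • w, interior_maximal (t := {x | g₀ x < 0})
        (fun x (hx : g₀ x < 0) => (hx.le : g₀ x ≤ 0)) ?_ ?_⟩
      · exact isOpen_lt hcont continuous_const
      · change g₀ _ < 0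
        rw [g₀.apply_add_smul, hz₀, hw]
        norm_num
    · exact det_mul_det_pos_of_wall hU hf hz₀ hlin
        ((h1.and hA).mono fun x h hx => h.2 (h.1 hx))
        ((h2.and hB).mono fun x h hx => h.2 (h.1 hx)) hdA hdB
    · rw [mul_comm]
      exact det_mul_det_pos_of_wall hU hf hz₀ hlin
        ((h2.and hB).mono fun x h hx => h.2 (h.1 hx))
        ((h1.and hA).mono fun x h hx => h.2 (h.1 hx)) hdB hdA
    · refine same {x | 0 ≤ g₀ x} ((convex_Ici (0 : ℝ)).affine_preimage g₀) ?_ hz₀.ge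
        ((h1.and h2).mono fun x h hx => ⟨h.1 hx, h.2 hx⟩)
      refine ⟨z + (1 : ℝ) • w, interior_maximal (t := {x | 0 < g₀ x})
        (fun x (hx : 0 < g₀ x) => (hx.le : 0 ≤ g₀ x)) ?_ ?_⟩
      · exact isOpen_lt continuous_const hcont
      · change 0 < g₀ _
        rw [g₀.apply_add_smul, hz₀, hw]
        norm_num
  · push Not at hg
    refine same Set.univ convex_univ (by simp) (Set.mem_univ z) ?_
    have : ∀ᶠ x in 𝓝 z, ∀ g ∈ F ∪ G, g x ≤ 0 := by
      refine (Filter.eventually_all_finite (hF.union hG)).2 fun g hgm => ?_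
      by_cases h0 : g = 0
      · simp [h0]
      have hlt : g z < 0 := lt_of_le_of_ne (hgm.elim (hFz g) (hGz g)) (hg g hgm h0)
      exact (g.continuous_of_finiteDimensional.continuousAt.eventually_lt
        continuousAt_const hlt).mono fun x hx => hx.le
    exact this.mono fun x hx _ => ⟨fun g hg => hx g (.inl hg), fun g hg => hx g (.inr hg)⟩

/-! ### Orientation behaviour of piecewise linear maps -/

/-- All affine pieces of a locally injective piecewise linear map through a point have
determinants of the same sign. Two generic points of a small ball are joined by a segment that
never meets two of the bounding hyperplanes at once, and the sign cannot change along it. -/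
theorem det_mul_det_pos [FiniteDimensional ℝ E] {f : E → E} {z₀ : E} {U : Set E}
    (hU : U ∈ 𝓝 z₀) (hf : Set.InjOn f U) {ι : Type} [Finite ι] {K : ι → Set E}
    {A : ι → E →ᵃ[ℝ] E} (hK : ∀ i, IsPolyhedron (K i)) (hd : IsPieceDecomp K z₀)
    (hA : ∀ᶠ x in 𝓝 z₀, ∀ i, x ∈ K i → f x = A i x) (i j : ι) :
    0 < LinearMap.det (A i).linear * LinearMap.det (A j).linear := by
  choose F hF hKF using hK
  obtain ⟨δ, hδ, hball⟩ := Metric.eventually_nhds_iff_ball.1 ((hd.cover.and hA).and hU)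
  set B := Metric.ball z₀ δ with hB
  have hBn : B ∈ 𝓝 z₀ := Metric.ball_mem_nhds _ hδ
  -- the non-trivial bounding functionals
  set H : Set (E →ᵃ[ℝ] ℝ) := {g | (∃ i, g ∈ F i) ∧ g ≠ 0} with hH
  have hHf : H.Finite := (Set.finite_iUnion hF).subset fun g hg => Set.mem_iUnion.2 hg.1
  have hne : ∀ k, (interior (K k ∩ B)).Nonempty := fun k =>
    (hd.convex k).interior_inter_nhds_nonempty (hd.interior_nonempty k) (hd.mem k) hBn
  obtain ⟨p, hp, hpH⟩ := exists_forall_ne_zero_of_isOpen hHf (fun g hg => hg.2)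
    isOpen_interior (hne i)
  -- `g` and `g'` vanish simultaneously on the line `p q` only if this functional vanishes at `q`
  set D : Set (E →ᵃ[ℝ] ℝ) := {d | (∃ g ∈ H, ∃ g' ∈ H, d = g p • g' - g' p • g) ∧ d ≠ 0} with hD
  have hDf : D.Finite := by
    refine ((hHf.prod hHf).image fun x : (E →ᵃ[ℝ] ℝ) × (E →ᵃ[ℝ] ℝ) =>
      x.1 p • x.2 - x.2 p • x.1).subset ?_
    rintro d ⟨⟨g, hg, g', hg', rfl⟩, -⟩
    exact ⟨(g, g'), ⟨hg, hg'⟩, rfl⟩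
  obtain ⟨q, hq, hqD⟩ := exists_forall_ne_zero_of_isOpen hDf (fun g hg => hg.2)
    isOpen_interior (hne j)
  have hpB : p ∈ B := (interior_subset hp).2
  have hqB : q ∈ B := (interior_subset hq).2
  set c : ℝ → E := fun t => p + t • (q - p) with hc
  have hcont : Continuous c := by fun_prop
  have hcB : ∀ t ∈ Set.Icc (0 : ℝ) 1, c t ∈ B := fun t ht => by
    have := (convex_ball z₀ δ).add_smul_sub_mem hpB hqB ht
    exact this
  -- the sign at a single point of the segment
  have hpt : ∀ t ∈ Set.Icc (0 : ℝ) 1, ∀ k l, c t ∈ K k → c t ∈ K l →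
      0 < LinearMap.det (A k).linear * LinearMap.det (A l).linear := by
    intro t ht k l hk hl
    have hBt : B ∈ 𝓝 (c t) := Metric.isOpen_ball.mem_nhds (hcB t ht)
    have hK' : ∀ k, c t ∈ K k → ∀ g ∈ F k, g (c t) ≤ 0 := fun k h => by rw [hKF k] at h; exact h
    refine det_mul_det_pos_of_one_wall hBt (hf.mono fun x hx => (hball x hx).2) (hF k) (hF l)
      (by rw [← hKF]; exact hd.interior_nonempty k) (by rw [← hKF]; exact hd.interior_nonempty l)
      (hK' k hk) (hK' l hl) ?_ ?_ ?_
    · filter_upwards [hBt] with x hx h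
      exact (hball x hx).1.2 k (by rw [hKF k]; exact h)
    · filter_upwards [hBt] with x hx h
      exact (hball x hx).1.2 l (by rw [hKF l]; exact h)
    · intro g hg g' hg' h0 h0' hz hz'
      have hgH : g ∈ H := ⟨hg.elim (fun h => ⟨k, h⟩) (fun h => ⟨l, h⟩), h0⟩
      have hgH' : g' ∈ H := ⟨hg'.elim (fun h => ⟨k, h⟩) (fun h => ⟨l, h⟩), h0'⟩
      have ht0 : t ≠ 0 := by
        rintro rfl
        exact hpH g hgH (by simpa [hc] using hz)
      have hd0 : g p • g' - g' p • g = 0 := by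
        by_contra hne
        refine hqD _ ⟨⟨g, hgH, g', hgH', rfl⟩, hne⟩ ?_
        have e1 := (g p • g' - g' p • g).apply_add_smul p (q - p) t
        have e2 := (g p • g' - g' p • g).apply_add_smul p (q - p) 1
        have e3 : (g p • g' - g' p • g) p = 0 := by simp [mul_comm]
        have e4 : (g p • g' - g' p • g) (c t) = 0 := by simp [hz, hz']
        rw [show p + t • (q - p) = c t from rfl, e3, e4, zero_add, eq_comm, smul_eq_mul] at e1
        rw [(mul_eq_zero.1 e1).resolve_left ht0, e3] at e2
        simpa using e2
      refine ⟨(g p)⁻¹ * g' p, ?_⟩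
      rw [mul_smul, ← sub_eq_zero.1 hd0, smul_smul, inv_mul_cancel₀ (hpH g hgH), one_smul]
  have key := isPreconnected_Icc.induction₂ (s := Set.Icc (0 : ℝ) 1) (fun s t => ∀ k l, c s ∈ K k →
    c t ∈ K l → 0 < LinearMap.det (A k).linear * LinearMap.det (A l).linear) ?_ ?_ ?_
    (Set.left_mem_Icc.2 zero_le_one) (Set.right_mem_Icc.2 zero_le_one) i j
  · exact key (by simpa [hc] using (interior_subset hp).1)
      (by simpa [hc] using (interior_subset hq).1)
  · intro t ht
    have hev : ∀ᶠ x in 𝓝 (c t), ∀ i, x ∈ K i → c t ∈ K i := by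
      refine Filter.eventually_all.2 fun i => ?_
      by_cases hi : c t ∈ K i
      · exact .of_forall fun _ _ => hi
      · filter_upwards [(hd.isClosed i).isOpen_compl.mem_nhds hi] with x hx h
        exact absurd h hx
    filter_upwards [(hcont.continuousAt.eventually hev).filter_mono nhdsWithin_le_nhds]
      with s hs k l hk hl
    exact hpt t ht k l hk (hs l hl)
  · intro s t u hs ht hu h1 h2 k l hk hl
    obtain ⟨i', hi'⟩ := (hball _ (hcB t ht)).1.1
    have e1 := h1 k i' hk hi'
    have e2 := h2 i' l hi' hl
    by_contra hcon
    nlinarith [mul_pos e1 e2, mul_self_nonneg (LinearMap.det (A i').linear)]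
  · intro s t hs ht h k l hk hl
    rw [mul_comm]
    exact h l k hl hk

/-- `f` preserves the orientation near `z`: its Jacobian determinant is positive wherever it
exists near `z`. -/
def PreservesOrientationAt (f : E → E) (z : E) : Prop :=
  ∀ᶠ x in 𝓝 z, DifferentiableAt ℝ f x → 0 < (fderiv ℝ f x).det

theorem AffineMap.hasFDerivAt_toContinuousLinearMap [FiniteDimensional ℝ E] (A : E →ᵃ[ℝ] E)
    (x : E) : HasFDerivAt A (LinearMap.toContinuousLinearMap A.linear) x := by
  have : (A : E → E) = fun y => LinearMap.toContinuousLinearMap A.linear y + A 0 := by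
    ext y
    have := A.apply_add_smul 0 y 1
    simp only [one_smul, zero_add] at this
    rw [this, add_comm]
    rfl
  rw [this]
  exact (ContinuousLinearMap.hasFDerivAt _).add_const _

theorem preservesOrientationAt_iff [FiniteDimensional ℝ E] {f : E → E} {z : E} {ι : Type}
    [Finite ι] {K : ι → Set E} {A : ι → E →ᵃ[ℝ] E} (hd : IsPieceDecomp K z)
    (hA : ∀ᶠ x in 𝓝 z, ∀ i, x ∈ K i → f x = A i x) :
    PreservesOrientationAt f z ↔ ∀ i, 0 < LinearMap.det (A i).linear := by
  constructor
  · intro h i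
    obtain ⟨y, hy⟩ := (hd.convex i).interior_inter_nhds_nonempty (hd.interior_nonempty i)
      (hd.mem i) (Filter.inter_mem h hA)
    have hfy : HasFDerivAt f (LinearMap.toContinuousLinearMap (A i).linear) y := by
      refine ((A i).hasFDerivAt_toContinuousLinearMap y).congr_of_eventuallyEq ?_
      filter_upwards [mem_interior_iff_mem_nhds.1 hy] with x hx
      exact hx.2.2 i hx.1
    have := (interior_subset hy).2.1 hfy.differentiableAt
    rwa [hfy.fderiv] at this
  · intro h
    filter_upwards [hd.cover, hA.eventually_nhds] with x ⟨i, hi⟩ hx hdiff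
    -- the derivative is determined by the restriction to a convex body
    have hu : UniqueDiffWithinAt ℝ (K i) x :=
      uniqueDiffWithinAt_convex (hd.convex i) (hd.interior_nonempty i) (subset_closure hi)
    have h1 := hdiff.hasFDerivAt.hasFDerivWithinAt (s := K i)
    have h2 : HasFDerivWithinAt f (LinearMap.toContinuousLinearMap (A i).linear) (K i) x := by
      refine ((A i).hasFDerivAt_toContinuousLinearMap x).hasFDerivWithinAt.congr_of_eventuallyEq
        ?_ (hx.self_of_nhds i hi)
      filter_upwards [hx.filter_mono nhdsWithin_le_nhds, self_mem_nhdsWithin] with y hy hyK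
      exact hy i hyK
    rw [hu.eq h1 h2]
    exact h i

/-- `f` is piecewise linear near `z`: a neighbourhood of `z` is covered by finitely many polyhedra
on each of which `f` is affine. -/
def IsPLAt (f : E → E) (z : E) : Prop :=
  ∃ (ι : Type) (_ : Finite ι) (K : ι → Set E) (A : ι → E →ᵃ[ℝ] E), (∀ i, IsPolyhedron (K i)) ∧
    (∀ᶠ x in 𝓝 z, ∃ i, x ∈ K i) ∧ ∀ᶠ x in 𝓝 z, ∀ i, x ∈ K i → f x = A i x

/-- Two piecewise linear maps are affine on the pieces of a common decomposition. -/
theorem IsPLAt.exists_common_decomp [FiniteDimensional ℝ E] {f g : E → E} {z : E}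
    (hf : IsPLAt f z) (hg : IsPLAt g z) :
    ∃ (ι : Type) (_ : Finite ι) (K : ι → Set E) (A B : ι → E →ᵃ[ℝ] E), (∀ i, IsPolyhedron (K i)) ∧
      IsPieceDecomp K z ∧ (∀ᶠ x in 𝓝 z, ∀ i, x ∈ K i → f x = A i x) ∧
      ∀ᶠ x in 𝓝 z, ∀ i, x ∈ K i → g x = B i x := by
  obtain ⟨ι, _, K, A, hK, hKc, hA⟩ := hf
  obtain ⟨κ, _, L, B, hL, hLc, hB⟩ := hg
  have hKL : ∀ i : ι × κ, IsPolyhedron (K i.1 ∩ L i.2) := fun i => (hK i.1).inter (hL i.2)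
  have hc : ∀ᶠ x in 𝓝 z, ∃ i : ι × κ, x ∈ K i.1 ∩ L i.2 := by
    filter_upwards [hKc, hLc] with x ⟨i, hi⟩ ⟨j, hj⟩
    exact ⟨(i, j), hi, hj⟩
  exact ⟨{i : ι × κ // z ∈ K i.1 ∩ L i.2 ∧ (interior (K i.1 ∩ L i.2)).Nonempty}, inferInstance,
    fun i => K i.1.1 ∩ L i.1.2, fun i => A i.1.1, fun i => B i.1.2, fun i => hKL i.1,
    isPieceDecomp_of_cover hKL hc, hA.mono fun x hx i hi => hx _ hi.1,
    hB.mono fun x hx i hi => hx _ hi.2⟩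

end PiecewiseLinear

/-! ### Comparing the orientations of charts -/

section ChartOrientation

variable {n : ℕ} {X : Type} [TopologicalSpace X]

/-- Orientations of charts at a point can be compared through a third chart `θ`, provided that
they are piecewise linear in the coordinates given by `θ`. -/
theorem sameOrientationAt_iff {x : X} {θ φ ψ : OpenPartialHomeomorph X (EuclideanSpace ℝ (Fin n))}
    (hθ : x ∈ θ.source) (hφ : x ∈ φ.source) (hψ : x ∈ ψ.source)
    (hf : IsPLAt (fun z => φ (θ.symm z)) (θ x)) (hg : IsPLAt (fun z => ψ (θ.symm z)) (θ x)) :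
    SameOrientationAt x φ ψ ↔ (SameOrientationAt x θ φ ↔ SameOrientationAt x θ ψ) := by
  obtain ⟨ι, _, K, A, B, hK, hd, hA, hB⟩ := hf.exists_common_decomp hg
  have hz : θ.symm (θ x) = x := θ.left_inv hθ
  have hzt : θ x ∈ θ.target := θ.map_source hθ
  have hsrc : ∀ χ : OpenPartialHomeomorph X (EuclideanSpace ℝ (Fin n)), x ∈ χ.source →
      (θ.symm.trans χ).source ∈ 𝓝 (θ x) := fun χ hχ =>
    (θ.symm.trans χ).open_source.mem_nhds (by simp [hzt, hz, hχ])
  have hfi : Set.InjOn (fun z => φ (θ.symm z)) (θ.symm.trans φ).source :=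
    (θ.symm.trans φ).injOn
  have hgi : Set.InjOn (fun z => ψ (θ.symm z)) (θ.symm.trans ψ).source :=
    (θ.symm.trans ψ).injOn
  have hAA := det_mul_det_pos (hsrc φ hφ) hfi hK hd hA
  have hBB := det_mul_det_pos (hsrc ψ hψ) hgi hK hd hB
  have hA0 : ∀ i, LinearMap.det (A i).linear ≠ 0 := fun i h => by simpa [h] using hAA i i
  have hB0 : ∀ i, LinearMap.det (B i).linear ≠ 0 := fun i h => by simpa [h] using hBB i i
  have hAbij : ∀ i, Function.Bijective (A i) := fun i => by
    rw [← AffineMap.linear_bijective_iff]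
    exact (Module.End.isUnit_iff _).1 ((LinearMap.isUnit_iff_isUnit_det _).2 (hA0 i).isUnit)
  set e : ι → EuclideanSpace ℝ (Fin n) ≃ᵃ[ℝ] EuclideanSpace ℝ (Fin n) := fun i =>
    AffineEquiv.ofBijective (hAbij i) with he
  have heA : ∀ i z, e i z = A i z := fun i z => rfl
  have hAx : ∀ i, A i (θ x) = φ x := fun i => by
    rw [← hA.self_of_nhds i (hd.mem i), hz]
  -- the pieces of the transition map are the images of the common pieces
  have hd' : IsPieceDecomp (fun i => e i '' K i) (φ x) := by
    refine ⟨fun i => ?_, fun i => (hd.convex i).affine_image (e i).toAffineMap, fun i => ?_,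
      fun i => ⟨θ x, hd.mem i, hAx i⟩, ?_⟩
    · exact (AffineEquiv.toContinuousAffineEquiv (e i)).toHomeomorph.isClosedMap _ (hd.isClosed i)
    · have := (AffineEquiv.toContinuousAffineEquiv (e i)).toHomeomorph.image_interior (K i)
      change e i '' _ = interior (e i '' _) at this
      rw [← this]
      exact (hd.interior_nonempty i).image _
    · have hc : Filter.Tendsto (fun w => θ (φ.symm w)) (𝓝 (φ x)) (𝓝 (θ x)) := by
        have h1 : Filter.Tendsto φ.symm (𝓝 (φ x)) (𝓝 x) := by
          have := φ.symm.continuousAt (φ.map_source hφ)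
          rwa [ContinuousAt, φ.left_inv hφ] at this
        exact (θ.continuousAt hθ).tendsto.comp h1
      have hs : ∀ᶠ w in 𝓝 (φ x), φ.symm w ∈ θ.source := by
        have := φ.symm.continuousAt (φ.map_source hφ)
        refine this.eventually ?_
        rw [φ.left_inv hφ]
        exact θ.open_source.mem_nhds hθ
      filter_upwards [hc.eventually (hd.cover.and hA), hs,
        φ.open_target.mem_nhds (φ.map_source hφ)] with w ⟨⟨i, hi⟩, hw⟩ hws hwt
      refine ⟨i, _, hi, ?_⟩
      rw [heA, ← hw i hi, θ.left_inv hws, φ.right_inv hwt]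
  have hC : ∀ᶠ w in 𝓝 (φ x), ∀ i, w ∈ e i '' K i →
      ψ (φ.symm w) = ((B i).comp (e i).symm.toAffineMap) w := by
    refine Filter.eventually_all.2 fun i => ?_
    have hc : Filter.Tendsto (e i).symm (𝓝 (φ x)) (𝓝 (θ x)) := by
      have := ((AffineEquiv.toContinuousAffineEquiv (e i).symm).continuous).tendsto (φ x)
      have h2 : (e i).symm (φ x) = θ x := by
        rw [← hAx i, ← heA, (e i).symm_apply_apply]
      rw [← h2]
      exact this
    filter_upwards [hc.eventually ((hA.and hB).and (hsrc φ hφ))]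
    rintro _ hw ⟨k, hk, rfl⟩
    rw [(e i).symm_apply_apply] at hw
    obtain ⟨⟨h1, h2⟩, h3⟩ := hw
    rw [OpenPartialHomeomorph.trans_source] at h3
    have h4 : φ.symm (e i k) = θ.symm k := by
      rw [heA, ← h1 i hk, φ.left_inv h3.2]
    rw [h4, h2 i hk]
    simp
  have hdet : ∀ i, LinearMap.det ((B i).comp (e i).symm.toAffineMap).linear *
      LinearMap.det (A i).linear = LinearMap.det (B i).linear := by
    intro i
    rw [← map_mul]
    congr 1
    ext1 v
    have : (A i).linear v = (e i).linear v := rfl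
    simp [this]
  have e1 : SameOrientationAt x φ ψ ↔ _ := preservesOrientationAt_iff hd' hC
  have e2 : SameOrientationAt x θ φ ↔ _ := preservesOrientationAt_iff hd hA
  have e3 : SameOrientationAt x θ ψ ↔ _ := preservesOrientationAt_iff hd hB
  rw [e1, e2, e3]
  obtain ⟨i, -⟩ := hd.cover.self_of_nhds
  have r : ∀ {P : ι → ℝ}, (∀ i j, 0 < P i * P j) → ((∀ k, 0 < P k) ↔ 0 < P i) := fun h =>
    ⟨fun h' => h' i, fun h' k => pos_of_mul_pos_right (h i k) h'.le⟩
  have hCC : ∀ k l, 0 < LinearMap.det ((B k).comp (e k).symm.toAffineMap).linear *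
      LinearMap.det ((B l).comp (e l).symm.toAffineMap).linear := by
    intro k l
    have h1 := hBB k l
    rw [← hdet k, ← hdet l, mul_mul_mul_comm] at h1
    exact pos_of_mul_pos_left h1 (hAA k l).le
  rw [r hAA, r hBB, r hCC, ← hdet i]
  have hC0 : LinearMap.det ((B i).comp (e i).symm.toAffineMap).linear ≠ 0 := fun h =>
    hB0 i (by rw [← hdet i, h, zero_mul])
  have ha0 := hA0 i
  generalize LinearMap.det ((B i).comp (e i).symm.toAffineMap).linear = c at hC0 ⊢
  generalize LinearMap.det (A i).linear = a at ha0 ⊢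
  rcases ha0.lt_or_gt with h | h
  · rcases hC0.lt_or_gt with h' | h'
    · simp [h.not_gt, h'.not_gt, mul_pos_of_neg_of_neg h' h]
    · simp [h.not_gt, h']
  · simp [h, mul_pos_iff_of_pos_right h]

/-- The orientation of a piecewise linear transition is decided by its derivative at points
arbitrarily close to the given one. -/
theorem sameOrientationAt_iff_of_frequently {x : X}
    {θ φ : OpenPartialHomeomorph X (EuclideanSpace ℝ (Fin n))}
    (hθ : x ∈ θ.source) (hφ : x ∈ φ.source)
    (hf : IsPLAt (fun z => φ (θ.symm z)) (θ x))
    {L : EuclideanSpace ℝ (Fin n) →L[ℝ] EuclideanSpace ℝ (Fin n)}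
    (hL : ∃ᶠ z in 𝓝 (θ x), HasFDerivAt (fun z => φ (θ.symm z)) L z) :
    SameOrientationAt x θ φ ↔ 0 < L.det := by
  constructor
  · intro h
    obtain ⟨z, hz, hz'⟩ := (hL.and_eventually h).exists
    have := hz' hz.differentiableAt
    rwa [hz.fderiv] at this
  · intro h
    obtain ⟨ι, _, K, A, B, hK, hd, hA, hB⟩ := hf.exists_common_decomp hf
    refine (preservesOrientationAt_iff hd hA).2 fun i => ?_
    have hz : θ.symm (θ x) = x := θ.left_inv hθ
    have hzt : θ x ∈ θ.target := θ.map_source hθ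
    have hsrc : (θ.symm.trans φ).source ∈ 𝓝 (θ x) :=
      (θ.symm.trans φ).open_source.mem_nhds (by simp [hzt, hz, hφ])
    have hAA := det_mul_det_pos hsrc (θ.symm.trans φ).injOn hK hd hA
    obtain ⟨z, hzL, ⟨j, hj⟩, hzA⟩ := (hL.and_eventually (hd.cover.and hA.eventually_nhds)).exists
    have hu : UniqueDiffWithinAt ℝ (K j) z :=
      uniqueDiffWithinAt_convex (hd.convex j) (hd.interior_nonempty j) (subset_closure hj)
    have h2 : HasFDerivWithinAt (fun z => φ (θ.symm z))
        (LinearMap.toContinuousLinearMap (A j).linear) (K j) z := by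
      refine ((A j).hasFDerivAt_toContinuousLinearMap z).hasFDerivWithinAt.congr_of_eventuallyEq
        ?_ (hzA.self_of_nhds j hj)
      filter_upwards [hzA.filter_mono nhdsWithin_le_nhds, self_mem_nhdsWithin] with y hy hyK
      exact hy j hyK
    rw [hu.eq hzL.hasFDerivWithinAt h2] at h
    exact pos_of_mul_pos_right (hAA j i) (le_of_lt h)

end ChartOrientation

/-! ### Simple polytopes near a vertex -/

noncomputable section

/-- The sign `(-1)^a` of an element of `ℤ₂`. -/
def zsign (a : ZMod 2) : ℝ := if a = 0 then 1 else -1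

@[simp] theorem zsign_zero : zsign 0 = 1 := by simp [zsign]

theorem zsign_add (a b : ZMod 2) : zsign (a + b) = zsign a * zsign b := by
  have h : ∀ a b : ZMod 2, (a + b = 0 ↔ (a = 0 ↔ b = 0)) := by decide
  unfold zsign
  by_cases ha : a = 0 <;> by_cases hb : b = 0 <;> simp [h, ha, hb]

theorem zsign_mul_self (a : ZMod 2) : zsign a * zsign a = 1 := by
  unfold zsign; split_ifs <;> norm_num

theorem zsign_pos_iff {a : ZMod 2} : 0 < zsign a ↔ a = 0 := by
  unfold zsign; split_ifs with h <;> simp [h]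

theorem zsign_sum {ι : Type*} (s : Finset ι) (f : ι → ZMod 2) :
    zsign (∑ i ∈ s, f i) = ∏ i ∈ s, zsign (f i) := by
  classical
  induction s using Finset.induction_on with
  | empty => simp
  | insert i s hi ih => rw [Finset.sum_insert hi, Finset.prod_insert hi, zsign_add, ih]

theorem zsign_mul_eq_neg_abs {a : ZMod 2} {x : ℝ} (h : zsign a * x ≤ 0) : zsign a * x = -|x| := by
  unfold zsign at *
  split_ifs at * with h0
  · rw [abs_of_nonpos (by linarith)]; ring
  · rw [abs_of_nonneg (by linarith)]; ring

theorem eq_zero_of_zsign_mul_eq {a b : ZMod 2} {x : ℝ} (h : zsign a * x = zsign b * x)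
    (hab : a - b ≠ 0) : x = 0 := by
  have e : ∀ a b : ZMod 2, a - b ≠ 0 → a + b = 1 := by decide
  have h1 : zsign (a + b) = -1 := by rw [e a b hab]; simp [zsign]
  have h2 : zsign (a + b) * x = x := by
    rw [zsign_add, mul_comm (zsign a), mul_assoc, h, ← mul_assoc, zsign_mul_self, one_mul]
  rw [h1] at h2
  linarith

namespace SimplePolytope

variable {n m : ℕ} (P : SimplePolytope n m)

theorem isClosed_carrier : IsClosed P.carrier := by
  have : P.carrier = ⋂ i, {x | inner ℝ (P.normal i) x ≤ P.offset i} := by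
    ext x; simp [carrier, halfspaceInter]
  rw [this]
  exact isClosed_iInter fun i => isClosed_le (by fun_prop) continuous_const

theorem convex_carrier : Convex ℝ P.carrier := by
  have : P.carrier = ⋂ i, {x | inner ℝ (P.normal i) x ≤ P.offset i} := by
    ext x; simp [carrier, halfspaceInter]
  rw [this]
  exact convex_iInter fun i => convex_halfSpace_le (innerₛₗ ℝ (P.normal i)).isLinear _

theorem isCompact_carrier : IsCompact P.carrier :=
  Metric.isCompact_of_isClosed_isBounded P.isClosed_carrier P.bounded

/-- Every face of `P` has a vertex. -/
theorem exists_vertex {p : EuclideanSpace ℝ (Fin n)} (hp : p ∈ P.carrier) :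
    ∃ v ∈ Set.extremePoints ℝ P.carrier, ∀ i, p ∈ P.facet i → v ∈ P.facet i := by
  set G : Set (EuclideanSpace ℝ (Fin n)) :=
    {x | x ∈ P.carrier ∧ ∀ i, p ∈ P.facet i → inner ℝ (P.normal i) x = P.offset i} with hG
  have hGc : IsClosed G := by
    have : G = P.carrier ∩ ⋂ i, ⋂ (_ : p ∈ P.facet i),
        {x | inner ℝ (P.normal i) x = P.offset i} := by
      ext x; simp [hG]
    rw [this]
    exact P.isClosed_carrier.inter (isClosed_iInter fun i => isClosed_iInter fun _ =>
      isClosed_eq (by fun_prop) continuous_const)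
  obtain ⟨v, hv⟩ := (P.isCompact_carrier.of_isClosed_subset hGc fun x hx =>
    hx.1).extremePoints_nonempty ⟨p, hp, fun i hi => hi.2⟩
  have hext : IsExtreme ℝ P.carrier G := by
    refine ⟨fun x hx => hx.1, ?_⟩
    rintro x hx y hy z ⟨-, hz⟩ ⟨a, b, ha, hb, hab, rfl⟩
    refine ⟨hx, fun i hi => ?_⟩
    have h1 := hz i hi
    rw [inner_add_right, inner_smul_right, inner_smul_right] at h1
    have h2 : inner ℝ (P.normal i) x ≤ P.offset i := hx i
    have h3 : inner ℝ (P.normal i) y ≤ P.offset i := hy i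
    refine le_antisymm h2 (not_lt.1 fun hlt => ?_)
    have h4 : a * inner ℝ (P.normal i) x < a * P.offset i := by gcongr
    have h5 : b * inner ℝ (P.normal i) y ≤ b * P.offset i := by gcongr
    have h6 : a * P.offset i + b * P.offset i = P.offset i := by rw [← add_mul, hab, one_mul]
    linarith
  exact ⟨v, hext.extremePoints_subset_extremePoints hv, fun i hi => ⟨hv.1.1, hv.1.2 i hi⟩⟩

/-- The vertices of `P`. -/
structure Vertex where
  val : EuclideanSpace ℝ (Fin n)
  isExtreme : val ∈ Set.extremePoints ℝ P.carrier

variable {P}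

/-- The indices of the facets containing the vertex `v`. -/
abbrev Vertex.Star (v : P.Vertex) : Type := {i : Fin m // v.1 ∈ P.facet i}

noncomputable instance (v : P.Vertex) : Fintype v.Star := Fintype.ofFinite _

theorem Vertex.mem_carrier (v : P.Vertex) : v.1 ∈ P.carrier := v.2.1

theorem Vertex.card_star (v : P.Vertex) : Fintype.card v.Star = n := by
  refine Eq.trans ?_ (P.simple v.1 v.2)
  rw [← Nat.card_eq_fintype_card]
  change _ = Nat.card _
  refine Nat.card_congr (Equiv.subtypeEquivRight fun i => ?_)
  exact ⟨fun h => h.2, fun h => ⟨v.mem_carrier, h⟩⟩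

theorem Vertex.eq_zero_of_inner_eq_zero (v : P.Vertex) {w : EuclideanSpace ℝ (Fin n)}
    (hw : ∀ i : v.Star, inner ℝ (P.normal i) w = 0) : w = 0 := by
  have key : ∀ w : EuclideanSpace ℝ (Fin n), (∀ i : v.Star, inner ℝ (P.normal i) w = 0) →
      ∀ᶠ t : ℝ in 𝓝[>] 0, v.1 + t • w ∈ P.carrier := by
    intro w hw
    have : ∀ᶠ t : ℝ in 𝓝[>] 0, ∀ i, inner ℝ (P.normal i) (v.1 + t • w) ≤ P.offset i := by
      refine Filter.eventually_all.2 fun i => ?_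
      by_cases hi : v.1 ∈ P.facet i
      · refine .of_forall fun t => ?_
        rw [inner_add_right, inner_smul_right, hw ⟨i, hi⟩, mul_zero, add_zero, hi.2]
      · have hlt : inner ℝ (P.normal i) v.1 < P.offset i :=
          lt_of_le_of_ne (v.mem_carrier i) fun h => hi ⟨v.mem_carrier, h⟩
        have : ∀ᶠ x in 𝓝 v.1, inner ℝ (P.normal i) x < P.offset i :=
          ContinuousAt.eventually_lt (by fun_prop) continuousAt_const hlt
        exact (this.along_ray w).mono fun t ht => ht.le
    exact this
  obtain ⟨t, ⟨h1, h2⟩, ht⟩ := (((key w hw).and (key (-w) (by simpa using hw))).and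
    self_mem_nhdsWithin).exists
  have := (mem_extremePoints.1 v.2).2 _ h1 _ h2 ⟨1 / 2, 1 / 2, by norm_num, by norm_num,
    by norm_num, by module⟩
  have h3 : t • w = 0 := by simpa using this.1
  exact (smul_eq_zero.1 h3).resolve_left (show (0 : ℝ) < t from ht).ne'

/-- The linear coordinates of `ℝⁿ` given by the normals of the `n` facets at a vertex. -/
def Vertex.coord (v : P.Vertex) : EuclideanSpace ℝ (Fin n) ≃ₗ[ℝ] (v.Star → ℝ) :=
  LinearMap.linearEquivOfInjective (LinearMap.pi fun i => innerₛₗ ℝ (P.normal i))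
    (by
      rw [injective_iff_map_eq_zero]
      intro w hw
      exact v.eq_zero_of_inner_eq_zero fun i => congrFun hw i)
    (by rw [finrank_euclideanSpace_fin, Module.finrank_fintype_fun_eq_card, v.card_star])

theorem Vertex.coord_apply (v : P.Vertex) (x : EuclideanSpace ℝ (Fin n)) (i : v.Star) :
    v.coord x i = inner ℝ (P.normal i) x := rfl

theorem Vertex.inner_eq (v : P.Vertex) (x : EuclideanSpace ℝ (Fin n)) (i : v.Star) :
    inner ℝ (P.normal i) x = P.offset i + v.coord (x - v.1) i := by
  rw [v.coord_apply, inner_sub_right, i.2.2]; ring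

theorem Vertex.coord_nonpos (v : P.Vertex) {x : EuclideanSpace ℝ (Fin n)} (hx : x ∈ P.carrier)
    (i : v.Star) : v.coord (x - v.1) i ≤ 0 := by
  have h : inner ℝ (P.normal i) x ≤ P.offset i := hx i
  rw [v.inner_eq] at h
  linarith

theorem Vertex.coord_eq_zero_iff (v : P.Vertex) {x : EuclideanSpace ℝ (Fin n)}
    (hx : x ∈ P.carrier) (i : v.Star) : v.coord (x - v.1) i = 0 ↔ x ∈ P.facet i := by
  constructor
  · intro h
    exact ⟨hx, by rw [v.inner_eq, h, add_zero]⟩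
  · intro h
    have := h.2
    rw [v.inner_eq] at this
    linarith

/-- The affine map which changes the signs of the facet coordinates at `v` according to `s`. -/
def Vertex.flip (v : P.Vertex) (s : v.Star → ZMod 2) :
    EuclideanSpace ℝ (Fin n) →ᵃ[ℝ] EuclideanSpace ℝ (Fin n) :=
  let M : EuclideanSpace ℝ (Fin n) →ₗ[ℝ] EuclideanSpace ℝ (Fin n) :=
    v.coord.symm.toLinearMap ∘ₗ (LinearMap.pi fun i => (zsign (s i) • LinearMap.id) ∘ₗ
      LinearMap.proj i) ∘ₗ v.coord.toLinearMap
  { toFun := fun x => v.1 + M (x - v.1)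
    linear := M
    map_vadd' := fun x w => by simp only [vadd_eq_add, add_sub_assoc, map_add]; abel }

theorem Vertex.coord_flip (v : P.Vertex) (s : v.Star → ZMod 2) (x : EuclideanSpace ℝ (Fin n))
    (i : v.Star) : v.coord (v.flip s x - v.1) i = zsign (s i) * v.coord (x - v.1) i := by
  change v.coord (v.1 + v.coord.symm _ - v.1) i = _
  rw [add_sub_cancel_left, LinearEquiv.apply_symm_apply]
  rfl

theorem Vertex.ext_coord (v : P.Vertex) {x y : EuclideanSpace ℝ (Fin n)}
    (h : ∀ i, v.coord (x - v.1) i = v.coord (y - v.1) i) : x = y :=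
  sub_left_injective (v.coord.injective (funext h))

theorem Vertex.flip_flip (v : P.Vertex) (s : v.Star → ZMod 2) (x : EuclideanSpace ℝ (Fin n)) :
    v.flip s (v.flip s x) = x :=
  v.ext_coord fun i => by
    rw [v.coord_flip, v.coord_flip, ← mul_assoc, zsign_mul_self, one_mul]

theorem Vertex.flip_congr (v : P.Vertex) {s t : v.Star → ZMod 2} {x : EuclideanSpace ℝ (Fin n)}
    (hx : x ∈ P.carrier) (h : ∀ i, s i - t i ≠ 0 → x ∈ P.facet i) : v.flip s x = v.flip t x :=
  v.ext_coord fun i => by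
    rw [v.coord_flip, v.coord_flip]
    by_cases hi : s i - t i = 0
    · rw [sub_eq_zero.1 hi]
    · rw [(v.coord_eq_zero_iff hx i).2 (h i hi), mul_zero, mul_zero]

theorem Vertex.det_flip (v : P.Vertex) (s : v.Star → ZMod 2) :
    LinearMap.det (v.flip s).linear = zsign (∑ i, s i) := by
  have h := LinearMap.det_conj (LinearMap.pi fun i => (zsign (s i) • LinearMap.id (R := ℝ) (M := ℝ))
    ∘ₗ LinearMap.proj i) v.coord.symm
  rw [LinearEquiv.symm_symm] at h
  rw [zsign_sum]
  change LinearMap.det (v.coord.symm.toLinearMap ∘ₗ _ ∘ₗ v.coord.toLinearMap) = _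
  rw [h, LinearMap.det_pi]
  simp

theorem Vertex.continuous_flip (v : P.Vertex) (s : v.Star → ZMod 2) : Continuous (v.flip s) :=
  (v.flip s).continuous_of_finiteDimensional

theorem Vertex.continuous_coord (v : P.Vertex) (i : v.Star) :
    Continuous fun x : EuclideanSpace ℝ (Fin n) => v.coord (x - v.1) i := by
  simp only [v.coord_apply]
  fun_prop

/-- The orthant at `v` that `flip s` maps onto the cone spanned by `P` at `v`. -/
def Vertex.orthant (v : P.Vertex) (s : v.Star → ZMod 2) : Set (EuclideanSpace ℝ (Fin n)) :=
  {x | ∀ i, zsign (s i) * v.coord (x - v.1) i ≤ 0}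

theorem Vertex.isPolyhedron_orthant (v : P.Vertex) (s : v.Star → ZMod 2) :
    IsPolyhedron (v.orthant s) := by
  let l : v.Star → EuclideanSpace ℝ (Fin n) →ₗ[ℝ] ℝ := fun i =>
    zsign (s i) • (LinearMap.proj i ∘ₗ v.coord.toLinearMap)
  refine ⟨Set.range fun i => (l i).toAffineMap - AffineMap.const ℝ _ (l i v.1),
    Set.finite_range _, ?_⟩
  ext x
  simp only [Vertex.orthant, Set.mem_ofPred_eq, Set.forall_mem_range]
  refine forall_congr' fun i => ?_
  simp [l, mul_sub]

theorem Vertex.isClosed_orthant (v : P.Vertex) (s : v.Star → ZMod 2) : IsClosed (v.orthant s) :=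
  (v.isPolyhedron_orthant s).isClosed

/-- The signs of the facet coordinates of a point. -/
def Vertex.signs (v : P.Vertex) (x : EuclideanSpace ℝ (Fin n)) : v.Star → ZMod 2 :=
  fun i => if 0 < v.coord (x - v.1) i then 1 else 0

theorem Vertex.mem_orthant_signs (v : P.Vertex) (x : EuclideanSpace ℝ (Fin n)) :
    x ∈ v.orthant (v.signs x) := by
  intro i
  unfold Vertex.signs
  split_ifs with h
  · simp only [zsign, one_ne_zero, if_false]; linarith
  · rw [zsign_zero, one_mul]; exact not_lt.1 h

/-- The map folding `ℝⁿ` onto the cone spanned by `P` at `v`: all facet coordinates are made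
non-positive. -/
def Vertex.fold (v : P.Vertex) (x : EuclideanSpace ℝ (Fin n)) : EuclideanSpace ℝ (Fin n) :=
  v.flip (v.signs x) x

theorem Vertex.coord_fold (v : P.Vertex) (x : EuclideanSpace ℝ (Fin n)) (i : v.Star) :
    v.coord (v.fold x - v.1) i = -|v.coord (x - v.1) i| := by
  rw [Vertex.fold, v.coord_flip]
  exact zsign_mul_eq_neg_abs (v.mem_orthant_signs x i)

theorem Vertex.flip_eq_fold (v : P.Vertex) {s : v.Star → ZMod 2} {x : EuclideanSpace ℝ (Fin n)}
    (h : x ∈ v.orthant s) : v.flip s x = v.fold x :=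
  v.ext_coord fun i => by rw [v.coord_fold, v.coord_flip]; exact zsign_mul_eq_neg_abs (h i)

theorem Vertex.flip_mem_orthant (v : P.Vertex) (s : v.Star → ZMod 2)
    {x : EuclideanSpace ℝ (Fin n)} (hx : x ∈ P.carrier) : v.flip s x ∈ v.orthant s := by
  intro i
  rw [v.coord_flip, ← mul_assoc, zsign_mul_self, one_mul]
  exact v.coord_nonpos hx i

theorem Vertex.fold_flip (v : P.Vertex) (s : v.Star → ZMod 2)
    {x : EuclideanSpace ℝ (Fin n)} (hx : x ∈ P.carrier) : v.fold (v.flip s x) = x := by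
  rw [← v.flip_eq_fold (v.flip_mem_orthant s hx), v.flip_flip]

theorem Vertex.continuous_fold (v : P.Vertex) : Continuous v.fold := by
  have h : v.fold = fun x => v.1 + v.coord.symm fun i => -|v.coord (x - v.1) i| := by
    ext1 x
    refine v.ext_coord fun i => ?_
    rw [v.coord_fold, add_sub_cancel_left, LinearEquiv.apply_symm_apply]
  rw [h]
  have h1 : Continuous v.coord.symm := v.coord.symm.toLinearMap.continuous_of_finiteDimensional
  exact continuous_const.add (h1.comp (continuous_pi fun i => (v.continuous_coord i).abs.neg))

/-- The open set of points satisfying strictly all inequalities of `P` except those of the facets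
at `v`; the points of `P` in it are those all of whose facets contain `v`. -/
def Vertex.openStar (v : P.Vertex) : Set (EuclideanSpace ℝ (Fin n)) :=
  {x | ∀ j, v.1 ∉ P.facet j → inner ℝ (P.normal j) x < P.offset j}

theorem Vertex.isOpen_openStar (v : P.Vertex) : IsOpen v.openStar := by
  have : v.openStar = ⋂ j, ⋂ (_ : v.1 ∉ P.facet j), {x | inner ℝ (P.normal j) x < P.offset j} := by
    ext x; simp [Vertex.openStar]
  rw [this]
  exact isOpen_iInter_of_finite fun i => isOpen_iInter_of_finite fun _ =>
    isOpen_lt (by fun_prop) continuous_const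

theorem Vertex.mem_openStar_iff (v : P.Vertex) {x : EuclideanSpace ℝ (Fin n)}
    (hx : x ∈ P.carrier) : x ∈ v.openStar ↔ ∀ i, x ∈ P.facet i → v.1 ∈ P.facet i := by
  constructor
  · intro h i hi
    by_contra hv
    exact (h i hv).ne hi.2
  · intro h j hj
    exact lt_of_le_of_ne (hx j) fun e => hj (h j ⟨hx, e⟩)

theorem Vertex.fold_mem_carrier (v : P.Vertex) {x : EuclideanSpace ℝ (Fin n)}
    (hx : v.fold x ∈ v.openStar) : v.fold x ∈ P.carrier := by
  intro i
  by_cases hi : v.1 ∈ P.facet i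
  · rw [v.inner_eq _ ⟨i, hi⟩, v.coord_fold]
    simp
  · exact (hx i hi).le

theorem exists_vertex_mem_openStar {p : EuclideanSpace ℝ (Fin n)} (hp : p ∈ P.carrier) :
    ∃ v : P.Vertex, p ∈ v.openStar := by
  obtain ⟨v, hv, h⟩ := P.exists_vertex hp
  exact ⟨⟨v, hv⟩, (Vertex.mem_openStar_iff ⟨v, hv⟩ hp).2 h⟩

end SimplePolytope
end

/-! ### Standard charts of `M(P, Λ)` -/

noncomputable section

namespace SimplePolytope

variable {n m : ℕ} {P : SimplePolytope n m} {r : ℕ} {Λ : Fin m → (Fin r → ZMod 2)}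

/-- The linear combinations of the colours of the facets at `v`. -/
def Vertex.comb (v : P.Vertex) (Λ : Fin m → (Fin r → ZMod 2)) :
    (v.Star → ZMod 2) →ₗ[ZMod 2] (Fin r → ZMod 2) :=
  Fintype.linearCombination (ZMod 2) (fun i : v.Star => Λ i)

theorem Vertex.comb_single (v : P.Vertex) (i : v.Star) :
    v.comb Λ (Pi.single i 1) = Λ i := by
  classical
  simp [Vertex.comb]

theorem Vertex.comb_injective (v : P.Vertex) (hΛ : P.IsVectorColouring Λ) :
    Function.Injective (v.comb Λ) :=
  (hΛ.2 v.1 v.2).fintypeLinearCombination_injective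

/-- A linear left inverse of `comb`: the coefficients of a vector in the colours of the facets at
`v` (extended linearly to all of `ℤ₂^r`). -/
def Vertex.coeff (v : P.Vertex) (hΛ : P.IsVectorColouring Λ) :
    (Fin r → ZMod 2) →ₗ[ZMod 2] (v.Star → ZMod 2) :=
  ((v.comb Λ).exists_leftInverse_of_injective (LinearMap.ker_eq_bot.2 (v.comb_injective hΛ))).choose

theorem Vertex.coeff_comb (v : P.Vertex) (hΛ : P.IsVectorColouring Λ) (s : v.Star → ZMod 2) :
    v.coeff hΛ (v.comb Λ s) = s :=
  LinearMap.congr_fun ((v.comb Λ).exists_leftInverse_of_injective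
    (LinearMap.ker_eq_bot.2 (v.comb_injective hΛ))).choose_spec s

/-- The parity of the number of facets at `v` needed to write a vector. -/
def Vertex.parity (v : P.Vertex) (hΛ : P.IsVectorColouring Λ) :
    (Fin r → ZMod 2) →ₗ[ZMod 2] ZMod 2 :=
  (∑ i : v.Star, LinearMap.proj i) ∘ₗ v.coeff hΛ

theorem Vertex.parity_apply (v : P.Vertex) (hΛ : P.IsVectorColouring Λ) (c : Fin r → ZMod 2) :
    v.parity hΛ c = ∑ i, v.coeff hΛ c i := by
  simp [Vertex.parity]

theorem Vertex.parity_colour (v : P.Vertex) (hΛ : P.IsVectorColouring Λ) (i : v.Star) :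
    v.parity hΛ (Λ i) = 1 := by
  rw [v.parity_apply, ← v.comb_single (Λ := Λ) i, v.coeff_comb]
  simp

theorem Vertex.mem_span_iff (v : P.Vertex) {p : EuclideanSpace ℝ (Fin n)} (hp : p ∈ P.carrier)
    (hpv : p ∈ v.openStar) {c : Fin r → ZMod 2} :
    c ∈ Submodule.span (ZMod 2) (Λ '' {i | p ∈ P.facet i}) ↔
      ∃ s, v.comb Λ s = c ∧ ∀ i : v.Star, s i ≠ 0 → p ∈ P.facet i := by
  classical
  constructor
  · intro h
    induction h using Submodule.span_induction with
    | mem c hc =>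
      obtain ⟨i, hi, rfl⟩ := hc
      refine ⟨Pi.single ⟨i, (v.mem_openStar_iff hp).1 hpv i hi⟩ 1, v.comb_single _, ?_⟩
      intro k hk
      have : k = ⟨i, (v.mem_openStar_iff hp).1 hpv i hi⟩ := by
        by_contra hne
        exact hk (Pi.single_eq_of_ne hne _)
      rw [this]
      exact hi
    | zero => exact ⟨0, map_zero _, fun i h => absurd rfl h⟩
    | add c d _ _ hc hd =>
      obtain ⟨s, rfl, hs⟩ := hc
      obtain ⟨t, rfl, ht⟩ := hd
      refine ⟨s + t, map_add _ _ _, fun i h => ?_⟩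
      by_cases h1 : s i = 0
      · exact ht i fun h2 => h (by simp [h1, h2])
      · exact hs i h1
    | smul a c _ hc =>
      obtain ⟨s, rfl, hs⟩ := hc
      exact ⟨a • s, map_smul _ _ _, fun i h => hs i fun h1 => h (by simp [h1])⟩
  · rintro ⟨s, rfl, hs⟩
    rw [Vertex.comb, Fintype.linearCombination_apply]
    refine Submodule.sum_mem _ fun i _ => ?_
    by_cases h : s i = 0
    · simp [h]
    · exact Submodule.smul_mem _ _ (Submodule.subset_span ⟨i, hs i h, rfl⟩)

theorem point_eq_iff {p q : P.carrier} {a b : Fin r → ZMod 2} :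
    P.point Λ p a = P.point Λ q b ↔ p = q ∧
      a - b ∈ Submodule.span (ZMod 2) (Λ '' {i | (p : EuclideanSpace ℝ (Fin n)) ∈ P.facet i}) :=
  Quotient.eq (r := P.glue Λ)

theorem exists_point (x : P.Space Λ) : ∃ p a, x = P.point Λ p a := by
  obtain ⟨⟨p, a⟩, rfl⟩ := Quotient.exists_rep x
  exact ⟨p, a, rfl⟩

theorem isQuotientMap_point :
    IsQuotientMap (fun x : P.carrier × (Fin r → ZMod 2) => P.point Λ x.1 x.2) :=
  isQuotientMap_quotient_mk'

theorem continuous_point (a : Fin r → ZMod 2) : Continuous fun p => P.point Λ p a :=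
  isQuotientMap_point.continuous.comp (by fun_prop : Continuous fun p : P.carrier => (p, a))

/-- The difference of two vectors representing the same point over the star of `v` is a
combination of colours of facets at `v`. -/
theorem Vertex.mem_range_comb (v : P.Vertex) {p : P.carrier} {a b : Fin r → ZMod 2}
    (hp : p.1 ∈ v.openStar) (h : P.point Λ p a = P.point Λ p b) :
    a - b ∈ LinearMap.range (v.comb Λ) := by
  obtain ⟨s, hs, -⟩ := (v.mem_span_iff p.2 hp).1 (point_eq_iff.1 h).2
  exact ⟨s, hs⟩

/-- The domain of the chart at `v` centred in the copy `P × {a}`. -/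
def Vertex.domain (v : P.Vertex) (Λ : Fin m → (Fin r → ZMod 2)) (a : Fin r → ZMod 2) :
    Set (P.Space Λ) :=
  {x | ∃ (q : P.carrier) (b : Fin r → ZMod 2), x = P.point Λ q b ∧ q.1 ∈ v.openStar ∧
    b - a ∈ LinearMap.range (v.comb Λ)}

theorem Vertex.point_mem_domain (v : P.Vertex) {a b : Fin r → ZMod 2} {q : P.carrier} :
    P.point Λ q b ∈ v.domain Λ a ↔ q.1 ∈ v.openStar ∧ b - a ∈ LinearMap.range (v.comb Λ) := by
  constructor
  · rintro ⟨q', b', h, hq, hb⟩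
    obtain ⟨rfl, -⟩ := point_eq_iff.1 h
    refine ⟨hq, ?_⟩
    have := Submodule.add_mem _ (v.mem_range_comb hq h) hb
    simpa using this
  · rintro ⟨h1, h2⟩
    exact ⟨q, b, rfl, h1, h2⟩

theorem Vertex.isOpen_domain (v : P.Vertex) (a : Fin r → ZMod 2) : IsOpen (v.domain Λ a) := by
  rw [← isQuotientMap_point.isOpen_preimage]
  have : (fun x : P.carrier × (Fin r → ZMod 2) => P.point Λ x.1 x.2) ⁻¹' v.domain Λ a =
      (fun x => x.1.1) ⁻¹' v.openStar ∩
        Prod.snd ⁻¹' {b | b - a ∈ LinearMap.range (v.comb Λ)} := by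
    ext x
    exact v.point_mem_domain
  rw [this]
  exact (v.isOpen_openStar.preimage (by fun_prop)).inter
    ((isOpen_discrete _).preimage continuous_snd)

/-- The chart map: on the copy `P × {b}` it flips the coordinates of the facets at `v` whose
colours occur in `b - a`. -/
def Vertex.chartFun (v : P.Vertex) (hΛ : P.IsVectorColouring Λ) (a : Fin r → ZMod 2)
    (x : P.Space Λ) : EuclideanSpace ℝ (Fin n) :=
  v.flip (v.coeff hΛ ((Quotient.out x).2 - a)) (Quotient.out x).1.1

theorem Vertex.chartFun_point (v : P.Vertex) (hΛ : P.IsVectorColouring Λ) (a b : Fin r → ZMod 2)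
    {q : P.carrier} (hq : q.1 ∈ v.openStar) :
    v.chartFun hΛ a (P.point Λ q b) = v.flip (v.coeff hΛ (b - a)) q := by
  have h : P.point Λ (Quotient.out (P.point Λ q b)).1 (Quotient.out (P.point Λ q b)).2 =
    P.point Λ q b := Quotient.out_eq _
  unfold Vertex.chartFun
  generalize (Quotient.out (P.point Λ q b)) = y at h ⊢
  obtain ⟨q', b'⟩ := y
  obtain ⟨e, h'⟩ := point_eq_iff.1 h
  dsimp only at e h' ⊢
  subst e
  obtain ⟨s, hs, hs'⟩ := (v.mem_span_iff q'.2 hq).1 h'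
  refine v.flip_congr q'.2 fun i hi => hs' i ?_
  rwa [← Pi.sub_apply, ← map_sub, sub_sub_sub_cancel_right, ← hs, v.coeff_comb] at hi

theorem Vertex.continuousOn_chartFun (v : P.Vertex) (hΛ : P.IsVectorColouring Λ)
    (a : Fin r → ZMod 2) : ContinuousOn (v.chartFun hΛ a) (v.domain Λ a) := by
  rw [isQuotientMap_point.continuousOn_isOpen_iff (v.isOpen_domain a)]
  have hc : Continuous fun x : P.carrier × (Fin r → ZMod 2) =>
      v.flip (v.coeff hΛ (x.2 - a)) x.1 := by
    rw [continuous_prod_of_discrete_right]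
    intro b
    exact (v.continuous_flip (v.coeff hΛ (b - a))).comp continuous_subtype_val
  refine hc.continuousOn.congr ?_
  rintro ⟨q, b⟩ hx
  exact v.chartFun_point hΛ a b (v.point_mem_domain.1 (Set.mem_preimage.1 hx)).1

/-- The inverse of the chart map. Off the chart's target, the vertex serves as a junk value. -/
def Vertex.chartInv (v : P.Vertex) (Λ : Fin m → (Fin r → ZMod 2)) (a : Fin r → ZMod 2)
    (z : EuclideanSpace ℝ (Fin n)) : P.Space Λ :=
  open Classical in
  if h : v.fold z ∈ P.carrier then P.point Λ ⟨v.fold z, h⟩ (a + v.comb Λ (v.signs z))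
  else P.point Λ ⟨v.1, v.mem_carrier⟩ a

theorem Vertex.chartInv_eq (v : P.Vertex) (a : Fin r → ZMod 2)
    {z : EuclideanSpace ℝ (Fin n)} (hz : v.fold z ∈ v.openStar) {s : v.Star → ZMod 2}
    (hs : z ∈ v.orthant s) : v.chartInv Λ a z =
      P.point Λ ⟨v.fold z, v.fold_mem_carrier hz⟩ (a + v.comb Λ s) := by
  rw [Vertex.chartInv, dif_pos (v.fold_mem_carrier hz), point_eq_iff]
  refine ⟨rfl, (v.mem_span_iff (v.fold_mem_carrier hz) hz).2 ⟨v.signs z - s, ?_, ?_⟩⟩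
  · rw [map_sub]; abel
  · intro i hi
    have h0 : v.coord (z - v.1) i = 0 := eq_zero_of_zsign_mul_eq (by
      rw [zsign_mul_eq_neg_abs (hs i), zsign_mul_eq_neg_abs (v.mem_orthant_signs z i)]) hi
    rw [← v.coord_eq_zero_iff (v.fold_mem_carrier hz), v.coord_fold, h0, abs_zero, neg_zero]

theorem Vertex.continuousOn_chartInv (v : P.Vertex) (a : Fin r → ZMod 2) :
    ContinuousOn (v.chartInv Λ a) (v.fold ⁻¹' v.openStar) := by
  rw [continuousOn_iff_continuous_domRestrict]
  refine (locallyFinite_of_finite fun s : v.Star → ZMod 2 =>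
    (Subtype.val ⁻¹' v.orthant s : Set (v.fold ⁻¹' v.openStar))).continuous ?_
    (fun s => (v.isClosed_orthant s).preimage continuous_subtype_val) fun s => ?_
  · exact Set.iUnion_eq_univ_iff.2 fun z => ⟨v.signs z.1, v.mem_orthant_signs z.1⟩
  · have hc : Continuous fun z : v.fold ⁻¹' v.openStar =>
        P.point Λ ⟨v.fold z.1, v.fold_mem_carrier z.2⟩ (a + v.comb Λ s) :=
      (continuous_point _).comp
        ((v.continuous_fold.comp continuous_subtype_val).subtype_mk _)
    exact hc.continuousOn.congr fun z hz => v.chartInv_eq a z.2 hz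

/-- The standard chart of `M(P, Λ)` at the vertex `v` of the copy `P × {a}`: the copies of `P`
around that vertex are unfolded onto the orthants at `v`. It restricts to the identity on
`P × {a}`. -/
def Vertex.chart (v : P.Vertex) (hΛ : P.IsVectorColouring Λ) (a : Fin r → ZMod 2) :
    OpenPartialHomeomorph (P.Space Λ) (EuclideanSpace ℝ (Fin n)) where
  toFun := v.chartFun hΛ a
  invFun := v.chartInv Λ a
  source := v.domain Λ a
  target := v.fold ⁻¹' v.openStar
  map_source' := by
    rintro _ ⟨q, b, rfl, hq, hb⟩
    rw [v.chartFun_point hΛ a b hq, Set.mem_preimage, v.fold_flip _ q.2]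
    exact hq
  map_target' := by
    intro z hz
    rw [v.chartInv_eq a hz (v.mem_orthant_signs z), v.point_mem_domain]
    exact ⟨hz, by simp⟩
  left_inv' := by
    rintro _ ⟨q, b, rfl, hq, s, hs⟩
    have hf := v.fold_flip (v.coeff hΛ (b - a)) q.2
    rw [v.chartFun_point hΛ a b hq, v.chartInv_eq a (by rwa [hf])
      (v.flip_mem_orthant (v.coeff hΛ (b - a)) q.2)]
    congr 1
    · exact Subtype.ext hf
    · rw [← hs, v.coeff_comb, hs]; abel
  right_inv' := by
    intro z hz
    rw [v.chartInv_eq a hz (v.mem_orthant_signs z),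
      v.chartFun_point hΛ a _ (q := ⟨v.fold z, v.fold_mem_carrier hz⟩) hz,
      add_sub_cancel_left, v.coeff_comb]
    exact v.flip_flip _ _
  open_source := v.isOpen_domain a
  open_target := v.isOpen_openStar.preimage v.continuous_fold
  continuousOn_toFun := v.continuousOn_chartFun hΛ a
  continuousOn_invFun := v.continuousOn_chartInv a

theorem Vertex.point_mem_chart_source (v : P.Vertex) (hΛ : P.IsVectorColouring Λ)
    {a b : Fin r → ZMod 2} {q : P.carrier} :
    P.point Λ q b ∈ (v.chart hΛ a).source ↔
      q.1 ∈ v.openStar ∧ b - a ∈ LinearMap.range (v.comb Λ) :=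
  v.point_mem_domain

theorem Vertex.chart_point (v : P.Vertex) (hΛ : P.IsVectorColouring Λ) (a b : Fin r → ZMod 2)
    {q : P.carrier} (hq : q.1 ∈ v.openStar) :
    v.chart hΛ a (P.point Λ q b) = v.flip (v.coeff hΛ (b - a)) q :=
  v.chartFun_point hΛ a b hq

theorem Vertex.chart_mem_plCharts (v : P.Vertex) (hΛ : P.IsVectorColouring Λ)
    (a : Fin r → ZMod 2) : v.chart hΛ a ∈ P.plCharts Λ := by
  intro b p hp
  refine ⟨{q | q.1 ∈ v.openStar}, (v.isOpen_openStar.preimage continuous_subtype_val).mem_nhds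
    (v.point_mem_domain.1 hp).1, 1, fun _ => Set.univ, fun _ => v.flip (v.coeff hΛ (b - a)),
    fun _ => ⟨0, Fin.elim0, Fin.elim0, ?_⟩, fun _ _ => ⟨0, trivial⟩, fun q hq _ _ =>
    v.chart_point hΛ a b hq⟩
  ext x
  simp [halfspaceInter]

end SimplePolytope
end

/-! ### Local orientations of `M(P, Λ)` -/

noncomputable section

theorem IsConvexPolyhedron.isPolyhedron {n : ℕ} {K : Set (EuclideanSpace ℝ (Fin n))}
    (hK : IsConvexPolyhedron K) : IsPolyhedron K := by
  obtain ⟨k, u, c, rfl⟩ := hK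
  refine ⟨Set.range fun i => (innerₛₗ ℝ (u i)).toAffineMap - AffineMap.const ℝ _ (c i),
    Set.finite_range _, ?_⟩
  ext x
  simp only [halfspaceInter, Set.mem_ofPred_eq, Set.forall_mem_range]
  refine forall_congr' fun i => ?_
  simp

namespace SimplePolytope

variable {n m : ℕ} {P : SimplePolytope n m} {r : ℕ} {Λ : Fin m → (Fin r → ZMod 2)}

/-- Every chart of the piecewise linear structure is piecewise linear in the coordinates of a
standard chart. -/
theorem Vertex.isPLAt (v : P.Vertex) (hΛ : P.IsVectorColouring Λ) (a : Fin r → ZMod 2)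
    {φ : OpenPartialHomeomorph (P.Space Λ) (EuclideanSpace ℝ (Fin n))} (hφ : φ ∈ P.plCharts Λ)
    {x : P.Space Λ} (hx : x ∈ (v.chart hΛ a).source) (hxφ : x ∈ φ.source) :
    IsPLAt (fun z => φ ((v.chart hΛ a).symm z)) (v.chart hΛ a x) := by
  have hz₀ : v.fold (v.chart hΛ a x) ∈ v.openStar := (v.chart hΛ a).map_source hx
  have hinv : v.chartInv Λ a (v.chart hΛ a x) = x := (v.chart hΛ a).left_inv hx
  set z₀ := v.chart hΛ a x with hz₀def
  set p₀ : P.carrier := ⟨v.fold z₀, v.fold_mem_carrier hz₀⟩ with hp₀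
  have hloc : ∀ s : {s // z₀ ∈ v.orthant s},
      IsPLNear (fun q : P.carrier => φ (P.point Λ q (a + v.comb Λ s))) p₀ := fun s =>
    hφ _ _ (by rw [hp₀, ← v.chartInv_eq a hz₀ s.2, hinv]; exact hxφ)
  choose U hU k K A hK hcov hA using hloc
  choose V hV hVU using fun s => mem_nhds_subtype _ _ _ |>.1 (hU s)
  have hev : ∀ᶠ z in 𝓝 z₀, v.fold z ∈ v.openStar ∧ (∀ s, z ∈ v.orthant s → z₀ ∈ v.orthant s) ∧
      ∀ s, v.fold z ∈ V s := by
    refine ((v.isOpen_openStar.preimage v.continuous_fold).eventually_mem hz₀).and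
      (Filter.Eventually.and ?_ ?_)
    · refine Filter.eventually_all.2 fun s => ?_
      by_cases hs : z₀ ∈ v.orthant s
      · exact .of_forall fun _ _ => hs
      · filter_upwards [(v.isClosed_orthant s).isOpen_compl.mem_nhds hs] with z hz h
        exact absurd h hz
    · exact Filter.eventually_all.2 fun s => v.continuous_fold.continuousAt (hV s)
  refine ⟨Σ s : {s // z₀ ∈ v.orthant s}, Fin (k s), inferInstance,
    fun i => v.orthant i.1 ∩ v.flip i.1 ⁻¹' K i.1 i.2, fun i => (A i.1 i.2).comp (v.flip i.1),
    fun i => (v.isPolyhedron_orthant _).inter ((hK i.1 i.2).isPolyhedron.preimage _), ?_, ?_⟩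
  · filter_upwards [hev] with z ⟨h1, h2, h3⟩
    have hs := v.mem_orthant_signs z
    obtain ⟨i, hi⟩ := hcov ⟨v.signs z, h2 _ hs⟩ ⟨v.fold z, v.fold_mem_carrier h1⟩
      (hVU _ (h3 ⟨v.signs z, h2 _ hs⟩))
    exact ⟨⟨⟨v.signs z, h2 _ hs⟩, i⟩, hs, hi⟩
  · filter_upwards [hev] with z ⟨h1, h2, h3⟩ ⟨s, i⟩ ⟨hs, hi⟩
    have hi' : v.flip s z ∈ K s i := hi
    rw [v.flip_eq_fold hs] at hi'
    have := hA s ⟨v.fold z, v.fold_mem_carrier h1⟩ (hVU _ (h3 s)) i hi'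
    change φ (v.chartInv Λ a z) = A s i (v.flip s z)
    rw [v.flip_eq_fold hs, v.chartInv_eq a h1 hs]
    exact this

/-- Whether two charts of the piecewise linear structure have the same orientation at a point can
be decided by comparing both with a standard chart. -/
theorem Vertex.sameOrientationAt_iff (v : P.Vertex) (hΛ : P.IsVectorColouring Λ)
    (a : Fin r → ZMod 2) {φ ψ : OpenPartialHomeomorph (P.Space Λ) (EuclideanSpace ℝ (Fin n))}
    (hφ : φ ∈ P.plCharts Λ) (hψ : ψ ∈ P.plCharts Λ) {x : P.Space Λ}
    (hx : x ∈ (v.chart hΛ a).source) (hxφ : x ∈ φ.source) (hxψ : x ∈ ψ.source) :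
    SameOrientationAt x φ ψ ↔
      (SameOrientationAt x (v.chart hΛ a) φ ↔ SameOrientationAt x (v.chart hΛ a) ψ) :=
  _root_.sameOrientationAt_iff hx hxφ hxψ (v.isPLAt hΛ a hφ hx hxφ) (v.isPLAt hΛ a hψ hx hxψ)

/-- Two standard charts have the same orientation at `[p, b]` if and only if they flip, up to an
even number, the same number of coordinates on the copy `P × {b}`. -/
theorem Vertex.sameOrientationAt_chart_iff (v w : P.Vertex) (hΛ : P.IsVectorColouring Λ)
    {a a' b : Fin r → ZMod 2} {p : P.carrier}
    (hv : P.point Λ p b ∈ (v.chart hΛ a).source) (hw : P.point Λ p b ∈ (w.chart hΛ a').source) :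
    SameOrientationAt (P.point Λ p b) (v.chart hΛ a) (w.chart hΛ a') ↔
      v.parity hΛ (b - a) = w.parity hΛ (b - a') := by
  obtain ⟨hpv, hbv⟩ := (v.point_mem_chart_source hΛ).1 hv
  obtain ⟨hpw, -⟩ := (w.point_mem_chart_source hΛ).1 hw
  set R := v.flip (v.coeff hΛ (b - a)) with hR
  set S := w.flip (w.coeff hΛ (b - a')) with hS
  have hp : v.chart hΛ a (P.point Λ p b) = R p := v.chart_point hΛ a b hpv
  have hfreq : ∃ᶠ q in 𝓝 p.1, q ∈ interior P.carrier := by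
    refine mem_closure_iff_frequently.1 ?_
    rw [P.convex_carrier.closure_interior_eq_closure_of_nonempty_interior P.full_dim]
    exact subset_closure p.2
  have hopen : ∀ᶠ q in 𝓝 p.1, q ∈ v.openStar ∧ q ∈ w.openStar :=
    (v.isOpen_openStar.eventually_mem hpv).and (w.isOpen_openStar.eventually_mem hpw)
  have hderiv : ∃ᶠ z in 𝓝 (v.chart hΛ a (P.point Λ p b)),
      HasFDerivAt (fun z => w.chart hΛ a' ((v.chart hΛ a).symm z))
        (LinearMap.toContinuousLinearMap (S.comp R).linear) z := by
    rw [hp]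
    refine (v.continuous_flip _).continuousAt.tendsto.frequently
      ((hfreq.and_eventually hopen).mono ?_)
    rintro q ⟨hq, hqv, hqw⟩
    refine ((S.comp R).hasFDerivAt_toContinuousLinearMap _).congr_of_eventuallyEq ?_
    have hnear : ∀ᶠ y in 𝓝 (R q), R y ∈ interior P.carrier ∩ (v.openStar ∩ w.openStar) := by
      have ho : IsOpen (interior P.carrier ∩ (v.openStar ∩ w.openStar)) :=
        isOpen_interior.inter (v.isOpen_openStar.inter w.isOpen_openStar)
      refine (v.continuous_flip _).continuousAt.eventually (ho.mem_nhds ?_)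
      rw [v.flip_flip]
      exact ⟨hq, hqv, hqw⟩
    filter_upwards [hnear] with y ⟨hy, hyv, hyw⟩
    have hyP : R y ∈ P.carrier := interior_subset hy
    have e1 : v.chart hΛ a (P.point Λ ⟨R y, hyP⟩ b) = y := by
      rw [v.chart_point hΛ a b (q := ⟨R y, hyP⟩) hyv]
      exact v.flip_flip _ _
    have e2 : (v.chart hΛ a).symm y = P.point Λ ⟨R y, hyP⟩ b := by
      conv_lhs => rw [← e1]
      exact (v.chart hΛ a).left_inv ((v.point_mem_chart_source hΛ).2 ⟨hyv, hbv⟩)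
    rw [e2, w.chart_point hΛ a' b (q := ⟨R y, hyP⟩) hyw]
    rfl
  rw [sameOrientationAt_iff_of_frequently hv hw
    (v.isPLAt hΛ a (w.chart_mem_plCharts hΛ a') hv hw) hderiv]
  have hdet : (LinearMap.toContinuousLinearMap (S.comp R).linear).det =
      zsign (w.parity hΛ (b - a') + v.parity hΛ (b - a)) := by
    rw [zsign_add, w.parity_apply, v.parity_apply, ← w.det_flip, ← v.det_flip, ← map_mul]
    rfl
  rw [hdet, zsign_pos_iff]
  have : ∀ s t : ZMod 2, t + s = 0 ↔ s = t := by decide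
  exact this _ _

theorem Vertex.nonempty_star (v : P.Vertex) (i : Fin m) : Nonempty v.Star := by
  by_contra h
  rw [not_nonempty_iff] at h
  have hn : n = 0 := by rw [← v.card_star, Fintype.card_eq_zero]
  subst hn
  obtain ⟨x, -, hx⟩ := P.irredundant i
  rw [Subsingleton.elim x v.val] at hx
  exact absurd (v.mem_carrier i) (not_le.2 hx)

/-- Near a vertex, a functional taking the value `1` on all colours is the parity. -/
theorem Vertex.parity_eq (v : P.Vertex) (hΛ : P.IsVectorColouring Λ)
    {l : (Fin r → ZMod 2) →ₗ[ZMod 2] ZMod 2} (hl : ∀ i, l (Λ i) = 1) {c : Fin r → ZMod 2}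
    (hc : c ∈ LinearMap.range (v.comb Λ)) : v.parity hΛ c = l c := by
  obtain ⟨s, rfl⟩ := hc
  rw [v.parity_apply, v.coeff_comb, Vertex.comb, Fintype.linearCombination_apply]
  simp [hl]

theorem Vertex.point_mem_chart_source_smul (v : P.Vertex) (hΛ : P.IsVectorColouring Λ)
    {p : P.carrier} (hp : p.1 ∈ v.openStar) (b : Fin r → ZMod 2) (t : ZMod 2) (i : v.Star) :
    P.point Λ p b ∈ (v.chart hΛ (b + t • Λ i)).source := by
  refine (v.point_mem_chart_source hΛ).2 ⟨hp, Pi.single i (-t), ?_⟩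
  have : (Pi.single i (-t) : v.Star → ZMod 2) = (-t) • Pi.single i 1 := by
    rw [← Pi.single_smul, smul_eq_mul, mul_one]
  rw [this, map_smul, v.comb_single, neg_smul, sub_add_cancel_left]

theorem Vertex.parity_sub_add_smul (v : P.Vertex) (hΛ : P.IsVectorColouring Λ)
    (b : Fin r → ZMod 2) (t : ZMod 2) (i : v.Star) :
    v.parity hΛ (b - (b + t • Λ i)) = t := by
  rw [sub_add_cancel_left, map_neg, map_smul, v.parity_colour, smul_eq_mul, mul_one]
  exact ZMod.neg_eq_self_mod_two t

/-- If some linear functional takes the value `1` on all colours, then `M(P, Λ)` is orientable: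
the copies `P × {a}` are oriented by the sign `(-1)^(l a)`. -/
theorem isOrientable_of_functional (hΛ : P.IsVectorColouring Λ)
    {l : (Fin r → ZMod 2) →ₗ[ZMod 2] ZMod 2} (hl : ∀ i, l (Λ i) = 1) :
    IsOrientable (P.plCharts Λ) := by
  refine ⟨{φ | ∃ (v : P.Vertex) (a : Fin r → ZMod 2), l a = 0 ∧ φ = v.chart hΛ a}, ?_, ?_, ?_⟩
  · rintro _ ⟨v, a, -, rfl⟩
    exact v.chart_mem_plCharts hΛ a
  · intro x
    obtain ⟨p, b, rfl⟩ := exists_point x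
    obtain ⟨v, hv⟩ := exists_vertex_mem_openStar p.2
    by_cases hb : l b = 0
    · exact ⟨_, ⟨v, b, hb, rfl⟩, (v.point_mem_chart_source hΛ).2 ⟨hv, by simp⟩⟩
    · have hm : Nonempty (Fin m) := by
        by_contra hm
        rw [not_nonempty_iff] at hm
        have hspan := hΛ.1
        rw [Set.range_eq_empty, Submodule.span_empty] at hspan
        have : b ∈ (⊥ : Submodule (ZMod 2) (Fin r → ZMod 2)) := hspan ▸ Submodule.mem_top
        rw [Submodule.mem_bot] at this
        exact hb (by rw [this, map_zero])
      obtain ⟨i⟩ := v.nonempty_star hm.some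
      refine ⟨_, ⟨v, b + (1 : ZMod 2) • Λ i, ?_, rfl⟩, v.point_mem_chart_source_smul hΛ hv b 1 i⟩
      have : ∀ t : ZMod 2, t ≠ 0 → t + 1 = 0 := by decide
      rw [map_add, map_smul, hl, smul_eq_mul, mul_one]
      exact this _ hb
  · rintro _ ⟨v, a, ha, rfl⟩ _ ⟨w, a', ha', rfl⟩ x hx hx'
    obtain ⟨p, b, rfl⟩ := exists_point x
    rw [v.sameOrientationAt_chart_iff w hΛ hx hx',
      v.parity_eq hΛ hl ((v.point_mem_chart_source hΛ).1 hx).2,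
      w.parity_eq hΛ hl ((w.point_mem_chart_source hΛ).1 hx').2, map_sub, map_sub, ha, ha']

end SimplePolytope
end

/-! ### Doublings of colourings and the orientation cover -/

noncomputable section

section OrientationCover

variable {n : ℕ} {X : Type} [TopologicalSpace X]

theorem SameOrientationAt.eventually {x : X}
    {φ ψ : OpenPartialHomeomorph X (EuclideanSpace ℝ (Fin n))} (hx : x ∈ φ.source)
    (h : SameOrientationAt x φ ψ) : ∀ᶠ y in 𝓝 x, SameOrientationAt y φ ψ :=
  (φ.continuousAt hx).eventually (Filter.Eventually.eventually_nhds h)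

variable {𝒞 : Set (OpenPartialHomeomorph X (EuclideanSpace ℝ (Fin n)))}

/-- The point of the orientation cover given by a point of a chart domain and the local
orientation of that chart. -/
def OrientationCover.mk (x : X) (φ : OpenPartialHomeomorph X (EuclideanSpace ℝ (Fin n)))
    (hφ : φ ∈ 𝒞) (hx : x ∈ φ.source) : OrientationCover 𝒞 :=
  ⟨x, Quot.mk _ ⟨φ, hφ, hx⟩⟩

theorem OrientationCover.exists_mk (o : OrientationCover 𝒞) :
    ∃ φ, ∃ (hφ : φ ∈ 𝒞) (hx : o.1 ∈ φ.source), o = OrientationCover.mk o.1 φ hφ hx := by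
  obtain ⟨x, o⟩ := o
  induction o using Quot.ind with
  | mk φ => exact ⟨φ.1, φ.2.1, φ.2.2, rfl⟩

theorem OrientationCover.isOpen_sheet
    {φ : OpenPartialHomeomorph X (EuclideanSpace ℝ (Fin n))} (hφ : φ ∈ 𝒞) {U : Set X}
    (hU : IsOpen U) (hUφ : U ⊆ φ.source) : IsOpen (OrientationCover.sheet φ hφ U) :=
  TopologicalSpace.isOpen_generateFrom_of_mem ⟨φ, hφ, U, hU, hUφ, rfl⟩

end OrientationCover

namespace SimplePolytope

variable {n m : ℕ} {P : SimplePolytope n m} {r : ℕ} {Λ : Fin m → (Fin r → ZMod 2)}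

theorem orientationCover_mk_eq_iff (hΛ : P.IsVectorColouring Λ) {x : P.Space Λ}
    {φ ψ : OpenPartialHomeomorph (P.Space Λ) (EuclideanSpace ℝ (Fin n))}
    (hφ : φ ∈ P.plCharts Λ) (hψ : ψ ∈ P.plCharts Λ) (hxφ : x ∈ φ.source) (hxψ : x ∈ ψ.source) :
    OrientationCover.mk x φ hφ hxφ = OrientationCover.mk x ψ hψ hxψ ↔
      SameOrientationAt x φ ψ := by
  constructor
  · intro h
    have h' := eq_of_heq (Sigma.mk.inj h).2
    obtain ⟨p, b, rfl⟩ := exists_point x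
    obtain ⟨v, hv⟩ := exists_vertex_mem_openStar p.2
    have hs : P.point Λ p b ∈ (v.chart hΛ b).source :=
      (v.point_mem_chart_source hΛ).2 ⟨hv, by simp⟩
    -- having the orientation of a fixed standard chart is a well-defined property of classes
    have := congrArg (Quot.lift (fun χ : {χ : OpenPartialHomeomorph (P.Space Λ)
        (EuclideanSpace ℝ (Fin n)) // χ ∈ P.plCharts Λ ∧ P.point Λ p b ∈ χ.source} =>
        SameOrientationAt (P.point Λ p b) (v.chart hΛ b) χ.1)
      fun χ χ' hχ => propext
        ((v.sameOrientationAt_iff hΛ b χ.2.1 χ'.2.1 hs χ.2.2 χ'.2.2).1 hχ)) h'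
    exact (v.sameOrientationAt_iff hΛ b hφ hψ hs hxφ hxψ).2 this.to_iff
  · intro h
    unfold OrientationCover.mk
    congr 1
    exact Quot.sound h

/-- A surjective linear map `f` of colourings with kernel `{0, κ}`, and a functional `l` that takes
the value `1` on `κ` and on all colours of the source. -/
structure IsDoubling {r s : ℕ} (Λ₁ : Fin m → (Fin s → ZMod 2)) (Λ₂ : Fin m → (Fin r → ZMod 2))
    (f : (Fin s → ZMod 2) →ₗ[ZMod 2] (Fin r → ZMod 2)) (κ : Fin s → ZMod 2)
    (l : (Fin s → ZMod 2) →ₗ[ZMod 2] ZMod 2) : Prop where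
  map_colour : ∀ i, f (Λ₁ i) = Λ₂ i
  surjective : Function.Surjective f
  map_eq_zero_iff : ∀ c, f c = 0 ↔ c = 0 ∨ c = κ
  functional_colour : ∀ i, l (Λ₁ i) = 1
  functional_kernel : l κ = 1

namespace IsDoubling

variable {s : ℕ} {Λ₁ : Fin m → (Fin s → ZMod 2)} {Λ₂ : Fin m → (Fin r → ZMod 2)}
  {f : (Fin s → ZMod 2) →ₗ[ZMod 2] (Fin r → ZMod 2)} {κ : Fin s → ZMod 2}
  {l : (Fin s → ZMod 2) →ₗ[ZMod 2] ZMod 2}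

theorem map_kernel (D : IsDoubling Λ₁ Λ₂ f κ l) (t : ZMod 2) : f (t • κ) = 0 := by
  rw [map_smul, (D.map_eq_zero_iff κ).2 (.inr rfl), smul_zero]

theorem exists_smul (D : IsDoubling Λ₁ Λ₂ f κ l) {c : Fin s → ZMod 2} (hc : f c = 0) :
    ∃ t : ZMod 2, c = t • κ := by
  rcases (D.map_eq_zero_iff c).1 hc with rfl | rfl
  · exact ⟨0, by simp⟩
  · exact ⟨1, by simp⟩

theorem map_comb (D : IsDoubling Λ₁ Λ₂ f κ l) (v : P.Vertex) (t : v.Star → ZMod 2) :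
    f (v.comb Λ₁ t) = v.comb Λ₂ t := by
  simp [Vertex.comb, Fintype.linearCombination_apply, D.map_colour]

/-- The sheet over the star of `v` containing `[q, c]` is determined by the value at `c` of this
functional, which vanishes on the colours at `v`. -/
def sheetIndex (_ : IsDoubling Λ₁ Λ₂ f κ l) (hΛ : P.IsVectorColouring Λ₂) (v : P.Vertex) :
    (Fin s → ZMod 2) →ₗ[ZMod 2] ZMod 2 :=
  l - v.parity hΛ ∘ₗ f

theorem sheetIndex_apply (D : IsDoubling Λ₁ Λ₂ f κ l) (hΛ : P.IsVectorColouring Λ₂)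
    (v : P.Vertex) (c : Fin s → ZMod 2) :
    D.sheetIndex hΛ v c = l c - v.parity hΛ (f c) := rfl

theorem sheetIndex_smul_kernel (D : IsDoubling Λ₁ Λ₂ f κ l) (hΛ : P.IsVectorColouring Λ₂)
    (v : P.Vertex) (t : ZMod 2) : D.sheetIndex hΛ v (t • κ) = t := by
  rw [sheetIndex_apply, D.map_kernel, map_zero, sub_zero, map_smul, D.functional_kernel,
    smul_eq_mul, mul_one]

theorem sheetIndex_eq (D : IsDoubling Λ₁ Λ₂ f κ l) (hΛ : P.IsVectorColouring Λ₂) {v : P.Vertex}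
    {p q : P.carrier} {c d : Fin s → ZMod 2} (hp : p.1 ∈ v.openStar)
    (h : P.point Λ₁ p c = P.point Λ₁ q d) : D.sheetIndex hΛ v c = D.sheetIndex hΛ v d := by
  obtain ⟨rfl, -⟩ := point_eq_iff.1 h
  obtain ⟨t, ht⟩ := v.mem_range_comb hp h
  rw [← sub_eq_zero, ← map_sub, ← ht, sheetIndex_apply, D.map_comb, v.parity_apply, v.coeff_comb,
    Vertex.comb, Fintype.linearCombination_apply]
  simp [D.functional_colour]

/-- The open set of points `[q, c]` over the star of `v` with a given sheet index. -/
def sheetOver (D : IsDoubling Λ₁ Λ₂ f κ l) (hΛ : P.IsVectorColouring Λ₂) (v : P.Vertex)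
    (t : ZMod 2) : Set (P.Space Λ₁) :=
  {y | ∃ (q : P.carrier) (c : Fin s → ZMod 2), y = P.point Λ₁ q c ∧ q.1 ∈ v.openStar ∧
    D.sheetIndex hΛ v c = t}

theorem point_mem_sheetOver (D : IsDoubling Λ₁ Λ₂ f κ l) (hΛ : P.IsVectorColouring Λ₂)
    {v : P.Vertex} {t : ZMod 2} {p : P.carrier} {c : Fin s → ZMod 2} :
    P.point Λ₁ p c ∈ D.sheetOver hΛ v t ↔ p.1 ∈ v.openStar ∧ D.sheetIndex hΛ v c = t := by
  constructor
  · rintro ⟨q, d, h, hq, hd⟩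
    have hp : p.1 ∈ v.openStar := by rw [(point_eq_iff.1 h).1]; exact hq
    exact ⟨hp, (D.sheetIndex_eq hΛ hp h).trans hd⟩
  · rintro ⟨hp, hc⟩
    exact ⟨p, c, rfl, hp, hc⟩

theorem isOpen_sheetOver (D : IsDoubling Λ₁ Λ₂ f κ l) (hΛ : P.IsVectorColouring Λ₂)
    (v : P.Vertex) (t : ZMod 2) : IsOpen (D.sheetOver hΛ v t) := by
  rw [← isQuotientMap_point.isOpen_preimage]
  have : (fun x : P.carrier × (Fin s → ZMod 2) => P.point Λ₁ x.1 x.2) ⁻¹' D.sheetOver hΛ v t =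
      (fun x => x.1.1) ⁻¹' v.openStar ∩ Prod.snd ⁻¹' {c | D.sheetIndex hΛ v c = t} := by
    ext x
    exact D.point_mem_sheetOver hΛ
  rw [this]
  exact (v.isOpen_openStar.preimage (by fun_prop)).inter
    ((isOpen_discrete _).preimage continuous_snd)

theorem inducedMap_point (D : IsDoubling Λ₁ Λ₂ f κ l) (p : P.carrier) (c : Fin s → ZMod 2) :
    P.inducedMap f D.map_colour (P.point Λ₁ p c) = P.point Λ₂ p (f c) := rfl

theorem isQuotientMap_inducedMap (D : IsDoubling Λ₁ Λ₂ f κ l) :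
    IsQuotientMap (P.inducedMap f D.map_colour) := by
  have hq : IsQuotientMap (Prod.map id f : P.carrier × (Fin s → ZMod 2) → _) :=
    (IsOpenMap.id.prodMap fun _ _ => isOpen_discrete _).isQuotientMap
      (continuous_id.prodMap continuous_of_discreteTopology)
      (Function.surjective_id.prodMap D.surjective)
  have hc := (isQuotientMap_point (P := P) (Λ := Λ₂)).comp hq
  exact IsQuotientMap.of_comp isQuotientMap_point.continuous
    (isQuotientMap_point.continuous_iff.2 hc.continuous) hc

theorem inducedMap_eq_iff (D : IsDoubling Λ₁ Λ₂ f κ l) {p q : P.carrier}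
    {c d : Fin s → ZMod 2} :
    P.inducedMap f D.map_colour (P.point Λ₁ p c) = P.inducedMap f D.map_colour (P.point Λ₁ q d) ↔
      ∃ t : ZMod 2, P.point Λ₁ p c = P.point Λ₁ q (d + t • κ) := by
  rw [D.inducedMap_point, D.inducedMap_point]
  constructor
  · intro h
    obtain ⟨rfl, hspan⟩ := point_eq_iff.1 h
    obtain ⟨v, hv⟩ := exists_vertex_mem_openStar p.2
    obtain ⟨x, hx, hx'⟩ := (v.mem_span_iff p.2 hv).1 hspan
    obtain ⟨t, ht⟩ := D.exists_smul (c := c - d - v.comb Λ₁ x)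
      (by rw [map_sub, map_sub, D.map_comb, hx, sub_self])
    refine ⟨t, point_eq_iff.2 ⟨rfl, (v.mem_span_iff p.2 hv).2 ⟨x, ?_, hx'⟩⟩⟩
    rw [← ht]
    abel
  · rintro ⟨t, h⟩
    have := congrArg (P.inducedMap f D.map_colour) h
    rwa [D.inducedMap_point, D.inducedMap_point, map_add, D.map_kernel, add_zero] at this

/-- Translation of the copies of `P` by a vector. -/
def translate (Λ : Fin m → (Fin r → ZMod 2)) (d : Fin r → ZMod 2) : P.Space Λ → P.Space Λ :=
  Quotient.map (fun x => (x.1, x.2 + d)) (by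
    rintro ⟨p, a⟩ ⟨q, b⟩ ⟨h, h'⟩
    exact ⟨h, by simpa using h'⟩)

theorem translate_point (d : Fin r → ZMod 2) (p : P.carrier) (a : Fin r → ZMod 2) :
    translate Λ d (P.point Λ p a) = P.point Λ p (a + d) := rfl

/-- The induced map is the quotient by the free involution which translates by `κ`; the two
sheets over the star of a vertex are told apart by `sheetIndex`. -/
theorem isCoveringMap (D : IsDoubling Λ₁ Λ₂ f κ l) (hΛ : P.IsVectorColouring Λ₂) :
    IsCoveringMap (P.inducedMap f D.map_colour) := by
  let _ : AddAction (ZMod 2) (P.Space Λ₁) :=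
    { vadd := fun t => translate Λ₁ (t • κ)
      zero_vadd := fun y => by
        obtain ⟨p, c, rfl⟩ := exists_point y
        change translate Λ₁ ((0 : ZMod 2) • κ) _ = _
        rw [translate_point, zero_smul, add_zero]
      add_vadd := fun t u y => by
        obtain ⟨p, c, rfl⟩ := exists_point y
        change translate Λ₁ ((t + u) • κ) _ = translate Λ₁ (t • κ) (translate Λ₁ (u • κ) _)
        rw [translate_point, translate_point, translate_point, add_smul, add_comm (t • κ),
          add_assoc] }
  have hv : ∀ (t : ZMod 2) p c, t +ᵥ P.point Λ₁ p c = P.point Λ₁ p (c + t • κ) :=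
    fun _ _ _ => rfl
  have : IsAddQuotientCoveringMap (P.inducedMap f D.map_colour) (ZMod 2) :=
    { toIsQuotientMap := D.isQuotientMap_inducedMap
      continuous_const_vadd := fun t => by
        rw [isQuotientMap_point.continuous_iff]
        exact isQuotientMap_point.continuous.comp (continuous_fst.prodMk
          ((continuous_of_discreteTopology (f := fun c : Fin s → ZMod 2 => c + t • κ)).comp
            continuous_snd))
      apply_eq_iff_mem_orbit := by
        intro y y'
        obtain ⟨p, c, rfl⟩ := exists_point y
        obtain ⟨q, d, rfl⟩ := exists_point y'
        rw [D.inducedMap_eq_iff]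
        exact exists_congr fun t => eq_comm
      disjoint := by
        intro y
        obtain ⟨p, c, rfl⟩ := exists_point y
        obtain ⟨v, hpv⟩ := exists_vertex_mem_openStar p.2
        refine ⟨D.sheetOver hΛ v (D.sheetIndex hΛ v c), (D.isOpen_sheetOver hΛ v _).mem_nhds
          ((D.point_mem_sheetOver hΛ).2 ⟨hpv, rfl⟩), ?_⟩
        rintro t ⟨_, ⟨_, ⟨q, d, rfl, hq, hd⟩, rfl⟩, hmem⟩
        dsimp only at hmem
        rw [hv, D.point_mem_sheetOver, map_add, hd, D.sheetIndex_smul_kernel] at hmem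
        simpa using hmem.2 }
  exact this.isCoveringMap

theorem ncard_fiber (D : IsDoubling Λ₁ Λ₂ f κ l) (hΛ : P.IsVectorColouring Λ₂) (x : P.Space Λ₂) :
    (P.inducedMap f D.map_colour ⁻¹' {x}).ncard = 2 := by
  obtain ⟨y, rfl⟩ := D.isQuotientMap_inducedMap.surjective x
  obtain ⟨p, c, rfl⟩ := exists_point y
  have : P.inducedMap f D.map_colour ⁻¹' {P.inducedMap f D.map_colour (P.point Λ₁ p c)} =
      {P.point Λ₁ p c, P.point Λ₁ p (c + κ)} := by
    ext y
    obtain ⟨q, d, rfl⟩ := exists_point y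
    rw [Set.mem_preimage, Set.mem_singleton_iff, D.inducedMap_eq_iff]
    constructor
    · rintro ⟨t, ht⟩
      have h2 : ∀ t : ZMod 2, t = 0 ∨ t = 1 := by decide
      rcases h2 t with rfl | rfl
      · left; simpa using ht
      · right; simpa using ht
    · rintro (h | h)
      · exact ⟨0, by simpa using h⟩
      · exact ⟨1, by simpa using h⟩
  rw [this, Set.ncard_pair]
  intro h
  obtain ⟨v, hv⟩ := exists_vertex_mem_openStar p.2
  have h1 := D.sheetIndex_eq hΛ hv h
  have h2 := D.sheetIndex_smul_kernel hΛ v 1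
  rw [one_smul] at h2
  rw [map_add, h2] at h1
  simp at h1

/-- The orientation `o` at the image of `y = [p, c]` is the one which gives the copy `P × {f c}`
the sign `(-1)^(l c)`, expressed through a standard chart. -/
def IsOrientationOf (_ : IsDoubling Λ₁ Λ₂ f κ l) (hΛ : P.IsVectorColouring Λ₂)
    (y : P.Space Λ₁) (o : OrientationCover (P.plCharts Λ₂)) : Prop :=
  ∃ (p : P.carrier) (c : Fin s → ZMod 2) (v : P.Vertex) (a : Fin r → ZMod 2)
    (hs : P.point Λ₂ p (f c) ∈ (v.chart hΛ a).source), y = P.point Λ₁ p c ∧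
    v.parity hΛ (f c - a) = l c ∧
    o = OrientationCover.mk (P.point Λ₂ p (f c)) (v.chart hΛ a) (v.chart_mem_plCharts hΛ a) hs

theorem exists_isOrientationOf (D : IsDoubling Λ₁ Λ₂ f κ l) (hΛ : P.IsVectorColouring Λ₂)
    (hm : Nonempty (Fin m)) (y : P.Space Λ₁) : ∃ o, D.IsOrientationOf hΛ y o := by
  obtain ⟨p, c, rfl⟩ := exists_point y
  obtain ⟨v, hv⟩ := exists_vertex_mem_openStar p.2
  obtain ⟨i⟩ := v.nonempty_star hm.some
  exact ⟨_, p, c, v, _, v.point_mem_chart_source_smul hΛ hv (f c) (l c) i, rfl,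
    v.parity_sub_add_smul hΛ (f c) (l c) i, rfl⟩

theorem IsOrientationOf.fst_eq (D : IsDoubling Λ₁ Λ₂ f κ l) {hΛ : P.IsVectorColouring Λ₂}
    {y : P.Space Λ₁} {o : OrientationCover (P.plCharts Λ₂)} (h : D.IsOrientationOf hΛ y o) :
    o.1 = P.inducedMap f D.map_colour y := by
  obtain ⟨p, c, v, a, hs, rfl, -, rfl⟩ := h
  rfl

theorem isOrientationOf_mk_iff (D : IsDoubling Λ₁ Λ₂ f κ l) {hΛ : P.IsVectorColouring Λ₂}
    {p : P.carrier} {c : Fin s → ZMod 2} {v : P.Vertex} {a : Fin r → ZMod 2}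
    (hs : P.point Λ₂ p (f c) ∈ (v.chart hΛ a).source) {o : OrientationCover (P.plCharts Λ₂)}
    (ho : D.IsOrientationOf hΛ (P.point Λ₁ p c) o) :
    o = OrientationCover.mk (P.point Λ₂ p (f c)) (v.chart hΛ a) (v.chart_mem_plCharts hΛ a) hs ↔
      v.parity hΛ (f c - a) = l c := by
  obtain ⟨q, d, w, a', hs', h, hpar, rfl⟩ := ho
  obtain ⟨rfl, -⟩ := point_eq_iff.1 h
  have hx := congrArg (P.inducedMap f D.map_colour) h
  rw [D.inducedMap_point, D.inducedMap_point] at hx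
  have hw := ((w.point_mem_chart_source hΛ).1 hs').1
  have hs'' : P.point Λ₂ p (f c) ∈ (w.chart hΛ a').source := hx ▸ hs'
  have : OrientationCover.mk (P.point Λ₂ p (f d)) (w.chart hΛ a') (w.chart_mem_plCharts hΛ a') hs'
      = OrientationCover.mk (P.point Λ₂ p (f c)) (w.chart hΛ a') (w.chart_mem_plCharts hΛ a')
        hs'' := by
    congr 1
    exact hx.symm
  have hidx := D.sheetIndex_eq hΛ hw h
  rw [D.sheetIndex_apply, D.sheetIndex_apply] at hidx
  have hpar' : w.parity hΛ (f c - a') = l c := by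
    rw [map_sub] at hpar ⊢
    linear_combination hpar - hidx
  rw [this, orientationCover_mk_eq_iff hΛ, w.sameOrientationAt_chart_iff v hΛ hs'' hs, hpar',
    eq_comm]

theorem IsOrientationOf.unique (D : IsDoubling Λ₁ Λ₂ f κ l) {hΛ : P.IsVectorColouring Λ₂}
    {y : P.Space Λ₁} {o o' : OrientationCover (P.plCharts Λ₂)} (h : D.IsOrientationOf hΛ y o)
    (h' : D.IsOrientationOf hΛ y o') : o = o' := by
  obtain ⟨p, c, v, a, hs, rfl, hpar, rfl⟩ := h'
  exact (D.isOrientationOf_mk_iff hs h).2 hpar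

theorem IsOrientationOf.injective (D : IsDoubling Λ₁ Λ₂ f κ l) {hΛ : P.IsVectorColouring Λ₂}
    {y y' : P.Space Λ₁} {o : OrientationCover (P.plCharts Λ₂)} (h : D.IsOrientationOf hΛ y o)
    (h' : D.IsOrientationOf hΛ y' o) : y = y' := by
  have hx := (IsOrientationOf.fst_eq D h).symm.trans (IsOrientationOf.fst_eq D h')
  obtain ⟨p, c, v, a, hs, rfl, hpar, rfl⟩ := h'
  obtain ⟨q, d, rfl⟩ := exists_point y
  obtain ⟨t, ht⟩ := D.inducedMap_eq_iff.1 hx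
  rw [ht] at h ⊢
  have hf : f (c + t • κ) = f c := by rw [map_add, D.map_kernel, add_zero]
  have h1 := (D.isOrientationOf_mk_iff (hf.symm ▸ hs) h).1 (by congr 1; rw [hf])
  rw [hf, hpar, map_add, map_smul, D.functional_kernel, smul_eq_mul, mul_one] at h1
  have : t = 0 := by simpa using h1
  rw [this, zero_smul, add_zero]

theorem IsOrientationOf.exists_of_orientation (D : IsDoubling Λ₁ Λ₂ f κ l)
    (hΛ : P.IsVectorColouring Λ₂) (hm : Nonempty (Fin m))
    (o : OrientationCover (P.plCharts Λ₂)) : ∃ y, D.IsOrientationOf hΛ y o := by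
  obtain ⟨φ, hφ, hx, ho⟩ := o.exists_mk
  obtain ⟨y, hy⟩ := D.isQuotientMap_inducedMap.surjective o.1
  obtain ⟨p, c, rfl⟩ := exists_point y
  rw [D.inducedMap_point] at hy
  generalize o.1 = x at hx ho hy
  subst hy ho
  obtain ⟨v, hv⟩ := exists_vertex_mem_openStar p.2
  obtain ⟨i⟩ := v.nonempty_star hm.some
  -- the two points of the fibre induce opposite orientations
  have hs := fun t : ZMod 2 => v.point_mem_chart_source_smul hΛ hv (f c) t i
  have hpar := fun t : ZMod 2 => v.parity_sub_add_smul hΛ (f c) t i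
  by_cases h : SameOrientationAt (P.point Λ₂ p (f c)) (v.chart hΛ (f c + l c • Λ₂ i)) φ
  · exact ⟨_, p, c, v, _, hs (l c), rfl, hpar (l c),
      ((orientationCover_mk_eq_iff hΛ _ hφ _ hx).2 h).symm⟩
  · have hf : f (c + κ) = f c := by
      rw [map_add, (D.map_eq_zero_iff κ).2 (.inr rfl), add_zero]
    have hl : l (c + κ) = l c + 1 := by rw [map_add, D.functional_kernel]
    have hne : ¬ SameOrientationAt (P.point Λ₂ p (f c)) (v.chart hΛ (f c + l c • Λ₂ i))
        (v.chart hΛ (f c + (l c + 1) • Λ₂ i)) := by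
      rw [v.sameOrientationAt_chart_iff v hΛ (hs _) (hs _), hpar, hpar]
      simp
    have h' : SameOrientationAt (P.point Λ₂ p (f c)) (v.chart hΛ (f c + (l c + 1) • Λ₂ i)) φ :=
      (v.sameOrientationAt_iff hΛ _ (v.chart_mem_plCharts hΛ _) hφ (hs (l c)) (hs _) hx).2
        (iff_of_false hne h)
    refine ⟨P.point Λ₁ p (c + κ), p, c + κ, v, f c + (l c + 1) • Λ₂ i, hf.symm ▸ hs _, rfl,
      by rw [hf, hl, hpar], ?_⟩
    rw [← (orientationCover_mk_eq_iff hΛ (v.chart_mem_plCharts hΛ _) hφ (hs _) hx).2 h']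
    congr 1
    rw [hf]

/-- The orientations of the copies of `P` by the signs `(-1)^(l c)` identify the source of a
doubling with the orientation cover of its target. -/
theorem exists_homeomorph_orientationCover (D : IsDoubling Λ₁ Λ₂ f κ l)
    (hΛ : P.IsVectorColouring Λ₂) (hm : Nonempty (Fin m)) :
    ∃ h : P.Space Λ₁ ≃ₜ OrientationCover (P.plCharts Λ₂),
      ∀ y, (h y).1 = P.inducedMap f D.map_colour y := by
  choose h hh using D.exists_isOrientationOf hΛ hm
  have hfst : ∀ y, (h y).1 = P.inducedMap f D.map_colour y := fun y =>
    IsOrientationOf.fst_eq D (hh y)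
  have hbij : Function.Bijective h := by
    constructor
    · intro y y' e
      exact IsOrientationOf.injective D (hh y) (e ▸ hh y')
    · intro o
      obtain ⟨y, hy⟩ := IsOrientationOf.exists_of_orientation D hΛ hm o
      exact ⟨y, IsOrientationOf.unique D (hh y) hy⟩
  have hcont : Continuous h := by
    refine continuous_generateFrom_iff.2 ?_
    rintro _ ⟨φ, hφ, U, hU, hUφ, rfl⟩
    rw [isOpen_iff_mem_nhds]
    rintro y ⟨x, hxφ, hxU, hxy⟩
    obtain ⟨p, c, rfl⟩ := exists_point y
    obtain ⟨v, hv⟩ := exists_vertex_mem_openStar p.2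
    obtain ⟨i⟩ := v.nonempty_star hm.some
    have hx : x = P.point Λ₂ p (f c) := by
      have := hfst (P.point Λ₁ p c)
      rw [hxy] at this
      exact this
    subst hx
    set a := f c + l c • Λ₂ i with ha
    have hs : P.point Λ₂ p (f c) ∈ (v.chart hΛ a).source :=
      v.point_mem_chart_source_smul hΛ hv (f c) (l c) i
    have hpar : v.parity hΛ (f c - a) = l c := v.parity_sub_add_smul hΛ (f c) (l c) i
    have hsame : SameOrientationAt (P.point Λ₂ p (f c)) (v.chart hΛ a) φ := by
      rw [← orientationCover_mk_eq_iff hΛ (v.chart_mem_plCharts hΛ a) hφ hs hxφ,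
        ← (D.isOrientationOf_mk_iff hs (hh (P.point Λ₁ p c))).2 hpar, hxy]
      rfl
    have hev : ∀ᶠ x' in 𝓝 (P.point Λ₂ p (f c)), x' ∈ U ∧ x' ∈ (v.chart hΛ a).source ∧
        SameOrientationAt x' (v.chart hΛ a) φ :=
      (hU.eventually_mem hxU).and (((v.chart hΛ a).open_source.eventually_mem hs).and
        (hsame.eventually hs))
    have hpull := D.isQuotientMap_inducedMap.continuous.continuousAt
      (x := P.point Λ₁ p c) |>.eventually hev
    filter_upwards [hpull, (D.isOpen_sheetOver hΛ v (D.sheetIndex hΛ v c)).mem_nhds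
      ((D.point_mem_sheetOver hΛ).2 ⟨hv, rfl⟩)]
    rintro _ ⟨h1, h2, h3⟩ ⟨q, d, rfl, hq, hd⟩
    rw [D.inducedMap_point] at h1 h2 h3
    refine ⟨P.point Λ₂ q (f d), hUφ h1, h1, ?_⟩
    have hpar' : v.parity hΛ (f d - a) = l d := by
      rw [D.sheetIndex_apply, D.sheetIndex_apply] at hd
      rw [map_sub] at hpar ⊢
      linear_combination hpar - hd
    rw [(D.isOrientationOf_mk_iff h2 (hh (P.point Λ₁ q d))).2 hpar']
    exact (orientationCover_mk_eq_iff hΛ _ hφ h2 (hUφ h1)).2 h3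
  -- sheets over images of open sets are open, as the covering is an open map
  have hopen : IsOpenMap h := by
    intro V hV
    rw [isOpen_iff_mem_nhds]
    rintro _ ⟨y, hy, rfl⟩
    obtain ⟨φ, hφ, hx, ho⟩ := (h y).exists_mk
    set W := V ∩ h ⁻¹' OrientationCover.sheet φ hφ φ.source with hW
    have hWo : IsOpen W :=
      hV.inter ((OrientationCover.isOpen_sheet hφ φ.open_source subset_rfl).preimage hcont)
    have hyW : y ∈ W := ⟨hy, _, hx, hx, ho⟩
    have hWφ : P.inducedMap f D.map_colour '' W ⊆ φ.source := by
      rintro _ ⟨y', ⟨-, x, hxφ, -, hy'⟩, rfl⟩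
      rw [← hfst, hy']
      exact hxφ
    refine Filter.mem_of_superset ((OrientationCover.isOpen_sheet hφ
      ((D.isCoveringMap hΛ).isOpenMap W hWo) hWφ).mem_nhds
      ⟨(h y).1, hx, ⟨y, hyW, (hfst y).symm⟩, ho⟩) ?_
    rintro _ ⟨x, hxφ, ⟨y', ⟨hy'V, x', hx'φ, -, hy'⟩, rfl⟩, rfl⟩
    refine ⟨y', hy'V, ?_⟩
    have : x' = P.inducedMap f D.map_colour y' := by rw [← hfst, hy']
    subst this
    exact hy'
  exact ⟨(Equiv.ofBijective h hbij).toHomeomorphOfContinuousOpen hcont hopen, hfst⟩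

end IsDoubling
end SimplePolytope
end

/-! ### The doubled colouring -/

noncomputable section

/-- The sum of the coordinates in the basis `b`, a linear functional: it is `1` on odd and `0` on
even vectors. -/
def coordSum {r : ℕ} (b : Module.Basis (Fin r) (ZMod 2) (Fin r → ZMod 2)) :
    (Fin r → ZMod 2) →ₗ[ZMod 2] ZMod 2 :=
  ∑ s, b.coord s

theorem coordSum_eq {r : ℕ} (b : Module.Basis (Fin r) (ZMod 2) (Fin r → ZMod 2))
    (v : Fin r → ZMod 2) : coordSum b v = (numNonzeroCoords b v : ZMod 2) := by
  classical
  have h : ∀ t : ZMod 2, t = 0 ∨ t = 1 := by decide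
  have hn : numNonzeroCoords b v = (Finset.univ.filter fun s => b.repr v s ≠ 0).card := by
    rw [numNonzeroCoords, Set.ncard_eq_toFinset_card']
    congr 1
    ext s
    simp
  rw [hn, Finset.card_filter, Nat.cast_sum, coordSum, LinearMap.sum_apply]
  refine Finset.sum_congr rfl fun s _ => ?_
  rw [Module.Basis.coord_apply]
  rcases h (b.repr v s) with h0 | h1
  · simp [h0]
  · simp [h1]

theorem coordSum_eq_one_iff {r : ℕ} (b : Module.Basis (Fin r) (ZMod 2) (Fin r → ZMod 2))
    (v : Fin r → ZMod 2) : coordSum b v = 1 ↔ Odd (numNonzeroCoords b v) := by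
  rw [coordSum_eq, ZMod.natCast_eq_one_iff_odd]

theorem coordSum_eq_zero_iff {r : ℕ} (b : Module.Basis (Fin r) (ZMod 2) (Fin r → ZMod 2))
    (v : Fin r → ZMod 2) : coordSum b v = 0 ↔ Even (numNonzeroCoords b v) := by
  rw [coordSum_eq, ZMod.natCast_eq_zero_iff_even]

/-- The functional on `ℤ₂^(r+1)` which adds the last coordinate to the sum of the coordinates of
the remaining part in the basis `b`. -/
def extendedCoordSum {r : ℕ} (b : Module.Basis (Fin r) (ZMod 2) (Fin r → ZMod 2)) :
    (Fin (r + 1) → ZMod 2) →ₗ[ZMod 2] ZMod 2 :=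
  coordSum b ∘ₗ collapseLast 0 + LinearMap.proj (Fin.last r)

theorem extendedCoordSum_inclLast {r : ℕ} (b : Module.Basis (Fin r) (ZMod 2) (Fin r → ZMod 2))
    (v : Fin r → ZMod 2) : extendedCoordSum b (inclLast v) = coordSum b v := by
  rw [extendedCoordSum, LinearMap.add_apply, LinearMap.comp_apply, collapseLast_inclLast]
  simp [inclLast]

theorem extendedCoordSum_lastVec {r : ℕ} (b : Module.Basis (Fin r) (ZMod 2) (Fin r → ZMod 2)) :
    extendedCoordSum b (lastVec r) = 1 := by
  rw [extendedCoordSum, LinearMap.add_apply, LinearMap.comp_apply, collapseLast_lastVec]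
  simp [lastVec]

theorem eq_inclLast_add_smul {r : ℕ} (c : Fin (r + 1) → ZMod 2) :
    c = inclLast (fun s => c s.castSucc) + c (Fin.last r) • lastVec r := by
  ext s
  induction s using Fin.lastCases with
  | last => simp [inclLast, lastVec]
  | cast s => simp [inclLast, lastVec, (Fin.castSucc_lt_last s).ne]

/-- `inclLast` as a linear map. -/
def inclLastLinear (r : ℕ) : (Fin r → ZMod 2) →ₗ[ZMod 2] (Fin (r + 1) → ZMod 2) where
  toFun := inclLast
  map_add' v w := by
    ext s
    induction s using Fin.lastCases <;> simp [inclLast]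
  map_smul' c v := by
    ext s
    induction s using Fin.lastCases <;> simp [inclLast]

theorem collapseLast_eq_zero_iff {r : ℕ} (w : Fin r → ZMod 2) (c : Fin (r + 1) → ZMod 2) :
    collapseLast w c = 0 ↔ c = 0 ∨ c = lastVec r + inclLast w := by
  have hww : w + w = 0 := by ext s; simp [CharTwo.add_self_eq_zero]
  constructor
  · intro h
    have hc := eq_inclLast_add_smul c
    rw [hc, map_add, map_smul, collapseLast_inclLast, collapseLast_lastVec] at h
    have h2 : ∀ t : ZMod 2, t = 0 ∨ t = 1 := by decide
    rcases h2 (c (Fin.last r)) with h0 | h1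
    · left
      rw [h0, zero_smul, add_zero] at h
      rw [hc, h, h0, zero_smul, add_zero]
      exact (inclLastLinear r).map_zero
    · right
      rw [h1, one_smul] at h
      rw [hc, h1, one_smul, add_right_cancel (h.trans hww.symm)]
      exact add_comm _ _
  · rintro (rfl | rfl)
    · exact map_zero _
    · rw [map_add, collapseLast_lastVec, collapseLast_inclLast, hww]

theorem isVectorColouring_doubleColouring {n m r : ℕ} {P : SimplePolytope n m}
    {Λ : Fin m → (Fin r → ZMod 2)} (hΛ : P.IsVectorColouring Λ) {j : Fin r → Fin m}
    {b : Module.Basis (Fin r) (ZMod 2) (Fin r → ZMod 2)} (hb : ∀ s, b s = Λ (j s)) {i₀ : Fin m}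
    (hi₀ : Even (numNonzeroCoords b (Λ i₀))) :
    P.IsVectorColouring (doubleColouring Λ b i₀) := by
  refine ⟨?_, fun v hv => ?_⟩
  · set W := Submodule.span (ZMod 2) (Set.range (doubleColouring Λ b i₀)) with hW
    have hmem : ∀ k, doubleColouring Λ b i₀ k ∈ W := fun k => Submodule.subset_span ⟨k, rfl⟩
    have hincl : ∀ v, inclLast v ∈ W := by
      have hle : (⊤ : Submodule (ZMod 2) (Fin r → ZMod 2)) ≤ W.comap (inclLastLinear r) := by
        rw [← b.span_eq, Submodule.span_le]
        rintro _ ⟨s, rfl⟩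
        -- the basis vectors are odd
        have hodd : Odd (numNonzeroCoords b (Λ (j s))) := by
          rw [← coordSum_eq_one_iff, ← hb, coordSum, LinearMap.sum_apply]
          classical
          simp [Finsupp.single_apply]
        have := hmem (j s)
        rw [doubleColouring, if_pos hodd, ← hb] at this
        exact this
      exact fun v => hle (Submodule.mem_top (x := v))
    have hlast : lastVec r ∈ W := by
      have := hmem i₀
      rw [doubleColouring, if_neg (Nat.not_odd_iff_even.2 hi₀)] at this
      have h1 := (Submodule.add_mem_iff_right W (hincl (Λ i₀))).1 this
      exact (Submodule.add_mem_iff_left W (hincl (Λ i₀))).1 h1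
    rw [eq_top_iff]
    intro c _
    rw [eq_inclLast_add_smul c]
    exact W.add_mem (hincl _) (W.smul_mem _ hlast)
  · refine LinearIndependent.of_comp (collapseLast (Λ i₀)) ?_
    convert hΛ.2 v hv using 1
    ext1 i
    exact collapseLast_doubleColouring Λ b i₀ i

theorem isDoubling_doubleColouring {m r : ℕ} (Λ : Fin m → (Fin r → ZMod 2))
    (b : Module.Basis (Fin r) (ZMod 2) (Fin r → ZMod 2)) {i₀ : Fin m}
    (hi₀ : Even (numNonzeroCoords b (Λ i₀))) :
    SimplePolytope.IsDoubling (doubleColouring Λ b i₀) Λ (collapseLast (Λ i₀))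
      (lastVec r + inclLast (Λ i₀)) (extendedCoordSum b) where
  map_colour := collapseLast_doubleColouring Λ b i₀
  surjective v := ⟨inclLast v, collapseLast_inclLast _ v⟩
  map_eq_zero_iff := collapseLast_eq_zero_iff (Λ i₀)
  functional_colour k := by
    have h₀ := (coordSum_eq_zero_iff b (Λ i₀)).2 hi₀
    unfold doubleColouring
    split_ifs with h
    · rw [extendedCoordSum_inclLast, coordSum_eq_one_iff]
      exact h
    · rw [map_add, map_add, extendedCoordSum_inclLast, extendedCoordSum_inclLast,
        extendedCoordSum_lastVec, h₀, (coordSum_eq_zero_iff b (Λ k)).2 (Nat.not_odd_iff_even.1 h),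
        zero_add, add_zero]
  functional_kernel := by
    rw [map_add, extendedCoordSum_lastVec, extendedCoordSum_inclLast,
      (coordSum_eq_zero_iff b (Λ i₀)).2 hi₀, add_zero]

end

theorem mainTheorem8 {n m r : ℕ} (P : SimplePolytope n m) (Λ : Fin m → (Fin r → ZMod 2))
    (hΛ : P.IsVectorColouring Λ) (hno : ¬ IsOrientable (P.plCharts Λ))
    (j : Fin r → Fin m) (b : Module.Basis (Fin r) (ZMod 2) (Fin r → ZMod 2))
    (hb : ∀ s, b s = Λ (j s)) :
    (∃ i₀, Even (numNonzeroCoords b (Λ i₀))) ∧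
    ∀ i₀, Even (numNonzeroCoords b (Λ i₀)) →
      P.IsVectorColouring (doubleColouring Λ b i₀) ∧
      IsOrientable (P.plCharts (doubleColouring Λ b i₀)) ∧
      IsCoveringMap (doubleCoverMap P Λ b i₀) ∧
      (∀ x, (doubleCoverMap P Λ b i₀ ⁻¹' {x}).ncard = 2) ∧
      ∃ h : P.Space (doubleColouring Λ b i₀) ≃ₜ OrientationCover (P.plCharts Λ),
        ∀ y, (h y).1 = doubleCoverMap P Λ b i₀ y := by
  refine ⟨?_, fun i₀ hi₀ => ?_⟩
  · by_contra h
    push Not at h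
    refine hno (SimplePolytope.isOrientable_of_functional hΛ (l := coordSum b) fun i => ?_)
    rw [coordSum_eq_one_iff]
    exact Nat.not_even_iff_odd.1 (h i)
  · have D := isDoubling_doubleColouring Λ b hi₀
    have hΛ' := isVectorColouring_doubleColouring hΛ hb hi₀
    exact ⟨hΛ', SimplePolytope.isOrientable_of_functional hΛ' D.functional_colour,
      D.isCoveringMap hΛ, D.ncard_fiber hΛ, D.exists_homeomorph_orientationCover hΛ ⟨i₀⟩⟩
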